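/- Let $k$ be a field, $S=k[y_1,y_2,y_3]$ with the standard grading, $f=y_1^3+y_1^2y_3-y_2^2y_3$ and $R=S/(f)$. Let $V(f)\subset\mathbb P^2(k)$ be the set of $k$-rational points of the curve $f=0$, let $s=(0:0:1)$ be its unique singular point, $\lambda_0=(0:1:0)$, and let $V(f)_{\mathrm{reg}}=V(f)\setminus\{s\}$ be the set of regular points. For $\lambda=(\lambda_1:\lambda_2:1)\in V(f)$ put \[ \alpha_\lambda=\begin{pmatrix} 0 & y_1-\lambda_1y_3 & y_2-\lambda_2y_3\\ y_1 & y_2+\lambda_2y_3 & (\lambda_1^2+\lambda_1)y_3\\ y_3 & 0 & -y_1-(\lambda_1+1)y_3 \end{pmatrix}, \] let $\beta_\lambda$ be the adjugate matrix of $\alpha_\lambda$, and let $\operatorname{Coker}\alpha_\lambda$ be the cokernel of the graded map $\alpha_\lambda:R(-2)^3\to R(-1)^3$ (acting on column vectors), with the induced $\mathbb Z$-grading. A graded maximal Cohen--Macaulay (MCM) $R$-module is a finitely generated $\mathbb Z$-graded $R$-module whose depth with respect to $(y_1,y_2,y_3)$ equals $\dim R$; a module is called three-generated if its minimal number of generators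 is $3$; the rank is the rank over the domain $R$. Then for every $\lambda=(\lambda_1:\lambda_2:1)\in V(f)$ the pair $(\alpha_\lambda,\beta_\lambda)$ is a graded matrix factorization of $f$, that is, both matrices have homogeneous entries and $\alpha_\lambda\beta_\lambda=\beta_\lambda\alpha_\lambda=f\cdot\mathbf 1_3$. For every $\lambda\in V(f)_{\mathrm{reg}}\setminus\{\lambda_0\}$ the module $\operatorname{Coker}\alpha_\lambda$ is a three-generated graded MCM $R$-module, and: (1) $\operatorname{Coker}\alpha_\lambda$ has rank $1$ for every $\lambda\in V(f)_{\mathrm{reg}}\setminus\{\lambda_0\}$. (2) For $\lambda\neq\xi$ in $V(f)_{\mathrm{reg}}\setminus\{\lambda_0\}$ the $R$-modules $\operatorname{Coker}\alpha_\lambda$ and $\operatorname{Coker}\alpha_\xi$ are not isomorphic. (3) Every three-generated graded MCM $R$-module of rank $1$ is isomorphic, as a graded module and up to a shift of the grading, to $\operatorname{Coker}\alpha_\lambda$ for some $\lambda\in V(f)_{\mathrm{reg}}\setminus\{\lambda_0\}$ or to $\operatorname{Coker}\alpha_s$. -/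

import Mathlib

noncomputable section

namespace NodalCone

open MvPolynomial

universe u v

/-- The cubic `f = y₁³ + y₁² y₃ - y₂² y₃` in `S = k[y₁, y₂, y₃]`, with `y₁, y₂, y₃` written
`X 0, X 1, X 2`. -/
def cubic (k : Type u) [Field k] : MvPolynomial (Fin 3) k :=
  X 0 ^ 3 + X 0 ^ 2 * X 2 - X 1 ^ 2 * X 2

/-- The hypersurface ring `R = S / (f)`. -/
abbrev NodeRing (k : Type u) [Field k] : Type u :=
  MvPolynomial (Fin 3) k ⧸ Ideal.span {cubic k}

/-- The quotient map `S → R`. -/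
abbrev quot (k : Type u) [Field k] : MvPolynomial (Fin 3) k →+* NodeRing k :=
  Ideal.Quotient.mk (Ideal.span {cubic k})

/-- The homogeneous component `R_n` for `n : ℤ`: the image of the forms of degree `n` if `n ≥ 0`,
and zero if `n < 0`. -/
def ringDeg (k : Type u) [Field k] : ℤ → AddSubgroup (NodeRing k)
  | Int.ofNat n =>
      (homogeneousSubmodule (Fin 3) k n).toAddSubgroup.map (quot k).toAddMonoidHom
  | Int.negSucc _ => ⊥

/-- The irrelevant maximal ideal `(y₁, y₂, y₃)` of `R`. -/
def irrelevant (k : Type u) [Field k] : Ideal (NodeRing k) :=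
  Ideal.span (Set.range fun i : Fin 3 => quot k (X i))

/-- `𝓜` is a `ℤ`-grading of the `R`-module `M`. -/
def IsGraded {k : Type u} [Field k] {M : Type v} [AddCommGroup M] [Module (NodeRing k) M]
    (𝓜 : ℤ → AddSubgroup M) : Prop :=
  DirectSum.IsInternal 𝓜 ∧
    ∀ (i j : ℤ) (r : NodeRing k) (m : M), r ∈ ringDeg k i → m ∈ 𝓜 j → r • m ∈ 𝓜 (i + j)

/-- `M`, with the grading `𝓜`, is a graded maximal Cohen–Macaulay `R`-module: finitely generated,
graded, and of depth `dim R`, that is, there is an `M`-regular sequence of length `dim R` in the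
irrelevant ideal. -/
def IsGradedMCM {k : Type u} [Field k] {M : Type v} [AddCommGroup M] [Module (NodeRing k) M]
    (𝓜 : ℤ → AddSubgroup M) : Prop :=
  Module.Finite (NodeRing k) M ∧ IsGraded (k := k) 𝓜 ∧
    ∃ rs : List (NodeRing k), (∀ r ∈ rs, r ∈ irrelevant k) ∧
      (rs.length : WithBot ℕ∞) = ringKrullDim (NodeRing k) ∧ RingTheory.Sequence.IsRegular M rs

/-- The minimal number of generators of `M` is `n`. -/
def IsMinimallyGenerated (k : Type u) [Field k] (M : Type v) [AddCommGroup M] [Module (NodeRing k) M]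
    (n : ℕ) : Prop :=
  (⊤ : Submodule (NodeRing k) M).spanRank = n

/-- `(A, B)` is a (graded) matrix factorization of `f`: the entries are homogeneous and
`A B = B A = f · 1`. -/
def IsMatrixFactorization {k : Type u} [Field k] {n : ℕ} (f : MvPolynomial (Fin 3) k)
    (A B : Matrix (Fin n) (Fin n) (MvPolynomial (Fin 3) k)) : Prop :=
  (∀ i j, ∃ d : ℕ, (A i j).IsHomogeneous d) ∧ (∀ i j, ∃ d : ℕ, (B i j).IsHomogeneous d) ∧
    A * B = f • (1 : Matrix (Fin n) (Fin n) (MvPolynomial (Fin 3) k)) ∧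
    B * A = f • (1 : Matrix (Fin n) (Fin n) (MvPolynomial (Fin 3) k))

/-- The cokernel of the map `R³ → R³` given by multiplication of column vectors by `A`. -/
abbrev Coker {k : Type u} [Field k]
    (A : Matrix (Fin 3) (Fin 3) (MvPolynomial (Fin 3) k)) : Type u :=
  (Fin 3 → NodeRing k) ⧸ LinearMap.range (Matrix.mulVecLin (A.map (quot k)))

/-- The grading on `Coker A` induced from the target of `A : R(-2)³ → R(-1)³`: the component of
degree `j` is the image of the vectors with all entries in `R(-1)_j = R_{j-1}`. -/
def cokerDeg {k : Type u} [Field k] (A : Matrix (Fin 3) (Fin 3) (MvPolynomial (Fin 3) k))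
    (j : ℤ) : AddSubgroup (Coker A) :=
  (AddSubgroup.pi Set.univ fun _ : Fin 3 => ringDeg k (j - 1)).map
    (LinearMap.range (Matrix.mulVecLin (A.map (quot k)))).mkQ.toAddMonoidHom

/-- Two graded modules are isomorphic up to a shift of the grading. -/
def IsoUpToShift {k : Type u} [Field k] {M : Type v} [AddCommGroup M] [Module (NodeRing k) M]
    {N : Type u} [AddCommGroup N] [Module (NodeRing k) N]
    (𝓜 : ℤ → AddSubgroup M) (𝓝 : ℤ → AddSubgroup N) : Prop :=
  ∃ (n : ℤ) (e : M ≃ₗ[NodeRing k] N), ∀ (j : ℤ) (m : M), m ∈ 𝓜 j ↔ e m ∈ 𝓝 (j + n)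

/-- The curve `V(f)` as a set of points of `ℙ²(k)`; as `f` is homogeneous, the choice of
representative does not matter. -/
def curve (k : Type u) [Field k] : Set (Projectivization k (Fin 3 → k)) :=
  {P | eval P.rep (cubic k) = 0}

/-- The point `(a : b : 1)`. -/
def pt {k : Type u} [Field k] (a b : k) : Projectivization k (Fin 3 → k) :=
  Projectivization.mk k ![a, b, 1] fun h => one_ne_zero (congrFun h 2)

/-- The point `λ₀ = (0 : 1 : 0)`. -/
def pt₀ (k : Type u) [Field k] : Projectivization k (Fin 3 → k) :=
  Projectivization.mk k ![0, 1, 0] fun h => one_ne_zero (congrFun h 1)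

/-- The set of regular points of the curve: those at which some partial derivative of `f` does not
vanish. -/
def regularLocus (k : Type u) [Field k] : Set (Projectivization k (Fin 3 → k)) :=
  {P | P ∈ curve k ∧ ∃ i, eval P.rep (pderiv i (cubic k)) ≠ 0}

/-- The matrix `α_λ` for `λ = (a : b : 1)`. -/
def alpha {k : Type u} [Field k] (a b : k) :
    Matrix (Fin 3) (Fin 3) (MvPolynomial (Fin 3) k) :=
  !![0, X 0 - C a * X 2, X 1 - C b * X 2;
     X 0, X 1 + C b * X 2, C (a ^ 2 + a) * X 2;
     X 2, 0, -X 0 - C (a + 1) * X 2]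

/-- The matrix `β_λ`, the adjoint (adjugate) of `α_λ`. -/
def beta {k : Type u} [Field k] (a b : k) :
    Matrix (Fin 3) (Fin 3) (MvPolynomial (Fin 3) k) :=
  (alpha a b).adjugate

end NodalCone

end

noncomputable section

namespace NodalCone

open MvPolynomial

universe u v

/-! The condition `b ^ 2 = a ^ 3 + a ^ 2` makes the determinant of `alpha a b` equal to f, so the
adjugate completes it to a matrix factorization (`det_alpha`). Since f is prime, a vector lies in
the image of α as soon as f divides its image under β (`exists_eq_alpha_mulVec`). This criterion
shows that the cokernel is torsion-free, that y₃, y₂ is a regular sequence on it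
(`isRegular_coker_alpha`), and that the last row of β embeds it into R, whence rank one
(`rank_coker_alpha`). Smoothness of the point is never needed, so everything also holds for α_s,
which is used in (3).

For (2), an isomorphism of cokernels lifts to the free covers. Its constant part U is invertible,
and comparing linear terms gives U α_λ(v) = α_ξ(v) W over k for every vector v
(`exists_matrix_of_linearMap`). The matrix equations at the three unit vectors force equal
parameters (`alpha_parameters_eq`).

For (3), put A = k[y₂, y₃]. Since f is monic in y₁, R is free over A with basis 1, y₁, y₁². Depth
two makes y₃, y₂ regular on M, by vanishing of Koszul cohomology (`X_two_smul_injective`,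
`exists_eq_X_two_smul`), so M has a homogeneous A-basis (`exists_homogeneous_basis`). It has three
elements because M has rank one over R (`card_eq_three_of_rank`), and they share one degree because
none of them is redundant as an R-generator (`degree_eq_degree`).

Hence y₁ acts on M by a matrix Φ = y₂ P + y₃ Q with P, Q over k, and f = 0 becomes Φ³ + y₃ Φ² = y₂²
y₃. Here P must be a single nilpotent Jordan block. A base change commuting with that block brings Q
to a normal form with two parameters a, b, and the remaining equations place (a : b : 1) on the
curve (`IsCubicPair.exists_normalForm`). The columns of Φ then express the relations `alpha a b`,
giving a surjection from the cokernel onto M. Both modules have rank one and the source is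
torsion-free, so it is an isomorphism (`isoUpToShift_of_relations`). -/

/-- The cubic as a monic polynomial in `y₁` over `k[y₂, y₃]`. -/
def monicCubic (k : Type u) [Field k] : Polynomial (MvPolynomial (Fin 2) k) :=
  Polynomial.X ^ 3 + Polynomial.C (X 1) * Polynomial.X ^ 2 - Polynomial.C (X 0 ^ 2 * X 1)

/-! ### The ring R: a domain of dimension two, free of rank three over k[y₂, y₃]. -/

section Ring

variable (k : Type u) [Field k]

theorem finSuccEquiv_cubic : finSuccEquiv k 2 (cubic k) = monicCubic k := by
  have h1 : finSuccEquiv k 2 (X 1) = Polynomial.C (X 0) := finSuccEquiv_X_succ (j := 0)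
  have h2 : finSuccEquiv k 2 (X 2) = Polynomial.C (X 1) := finSuccEquiv_X_succ (j := 1)
  simp only [cubic, monicCubic, map_add, map_sub, map_mul, map_pow, finSuccEquiv_X_zero, h1, h2]
  ring

theorem natDegree_monicCubic : (monicCubic k).natDegree = 3 := by
  unfold monicCubic
  compute_degree!

theorem monic_monicCubic : (monicCubic k).Monic := by
  unfold monicCubic
  monicity!

/-- Eisenstein's criterion at y₃: the constant term -y₂² y₃ contains y₃ exactly once. -/
theorem irreducible_monicCubic : Irreducible (monicCubic k) := by
  have hX : Prime (X 1 : MvPolynomial (Fin 2) k) := X_prime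
  have hp : (Ideal.span {(X 1 : MvPolynomial (Fin 2) k)}).IsPrime :=
    (Ideal.span_singleton_prime hX.ne_zero).2 hX
  refine Polynomial.IsEisensteinAt.irreducible (𝓟 := Ideal.span {X 1}) ⟨?_, ?_, ?_⟩ hp
    (monic_monicCubic k).isPrimitive (by rw [natDegree_monicCubic]; norm_num)
  · rw [(monic_monicCubic k).leadingCoeff]
    exact fun h => hp.ne_top ((Ideal.eq_top_iff_one _).2 h)
  · intro n hn
    rw [natDegree_monicCubic] at hn
    rw [Ideal.mem_span_singleton]
    interval_cases n
    · simp [monicCubic]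
    · simp [monicCubic, Polynomial.coeff_X_pow]
    · simp [monicCubic, Polynomial.coeff_X_pow]
  · rw [Ideal.span_singleton_pow, Ideal.mem_span_singleton]
    have : (monicCubic k).coeff 0 = -(X 0 ^ 2 * X 1) := by
      simp [monicCubic, Polynomial.coeff_zero_eq_eval_zero]
    rw [this, dvd_neg, pow_two (X 1), mul_dvd_mul_iff_right hX.ne_zero]
    intro h
    have := hX.dvd_of_dvd_pow h
    rw [X_dvd_X] at this
    simp at this

theorem prime_cubic : Prime (cubic k) := by
  have h := (irreducible_monicCubic k).prime
  rw [← finSuccEquiv_cubic] at h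
  exact (MulEquiv.prime_iff (finSuccEquiv k 2)).1 h

instance instIsDomainNodeRing : IsDomain (NodeRing k) :=
  (Ideal.Quotient.isDomain_iff_prime _).2
    ((Ideal.span_singleton_prime (prime_cubic k).ne_zero).2 (prime_cubic k))

theorem quot_eq_zero_iff {p : MvPolynomial (Fin 3) k} : quot k p = 0 ↔ cubic k ∣ p := by
  rw [Ideal.Quotient.eq_zero_iff_mem, Ideal.mem_span_singleton]

theorem isHomogeneous_cubic : (cubic k).IsHomogeneous 3 := by
  unfold cubic
  have h0 := isHomogeneous_X k (0 : Fin 3)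
  have h1 := isHomogeneous_X k (1 : Fin 3)
  have h2 := isHomogeneous_X k (2 : Fin 3)
  exact ((h0.pow 3).add ((h0.pow 2).mul h2)).sub ((h1.pow 2).mul h2)

/-- A nonzero form of degree less than three does not vanish in `R`. -/
theorem not_cubic_dvd {p : MvPolynomial (Fin 3) k} {n : ℕ} (hp : p.IsHomogeneous n) (h0 : p ≠ 0)
    (hn : n < 3) : ¬ cubic k ∣ p := by
  rintro ⟨q, rfl⟩
  have hq : q ≠ 0 := right_ne_zero_of_mul h0
  have h1 := hp.totalDegree h0
  rw [totalDegree_mul_of_isDomain (prime_cubic k).ne_zero hq,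
    (isHomogeneous_cubic k).totalDegree (prime_cubic k).ne_zero] at h1
  omega

theorem not_cubic_dvd_X (i : Fin 3) : ¬ cubic k ∣ X i :=
  not_cubic_dvd k (isHomogeneous_X k i) (X_ne_zero i) (by norm_num)

/-- The structure of `R` as an algebra over `k[y₂, y₃]`. -/
instance instAlgebraNodeRing : Algebra (MvPolynomial (Fin 2) k) (NodeRing k) :=
  ((quot k).comp (rename Fin.succ : MvPolynomial (Fin 2) k →ₐ[k] _).toRingHom).toAlgebra

instance instModuleNodeRing : Module (MvPolynomial (Fin 2) k) (NodeRing k) :=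
  (instAlgebraNodeRing k).toModule

theorem algebraMap_eq (a : MvPolynomial (Fin 2) k) :
    algebraMap (MvPolynomial (Fin 2) k) (NodeRing k) a = quot k (rename Fin.succ a) := rfl

theorem finSuccEquiv_rename_succ (a : MvPolynomial (Fin 2) k) :
    finSuccEquiv k 2 (rename Fin.succ a) = Polynomial.C a := by
  induction a using MvPolynomial.induction_on with
  | C r => simp [finSuccEquiv_apply]
  | add p q hp hq => simp [hp, hq]
  | mul_X p i hp => simp only [map_mul, hp, rename_X, finSuccEquiv_X_succ]

/-- The identification of `R` with the quotient of `k[y₂, y₃][y₁]` by the monic cubic. -/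
def quotientFinSuccEquiv : NodeRing k ≃+* AdjoinRoot (monicCubic k) :=
  Ideal.quotientEquiv (Ideal.span {cubic k}) (Ideal.span {monicCubic k})
    (finSuccEquiv k 2).toRingEquiv (by
      rw [Ideal.map_span, Set.image_singleton]
      exact congrArg (fun p => Ideal.span {p}) (finSuccEquiv_cubic k).symm)

theorem quotientFinSuccEquiv_quot (p : MvPolynomial (Fin 3) k) :
    quotientFinSuccEquiv k (quot k p) = AdjoinRoot.mk _ (finSuccEquiv k 2 p) := rfl

/-- `R` is obtained from `k[y₂, y₃]` by adjoining a root of the monic cubic. -/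
def adjoinRootEquiv : AdjoinRoot (monicCubic k) ≃ₐ[MvPolynomial (Fin 2) k] NodeRing k :=
  (AlgEquiv.ofRingEquiv (f := quotientFinSuccEquiv k) (fun a => by
    rw [algebraMap_eq, quotientFinSuccEquiv_quot, finSuccEquiv_rename_succ]
    rfl)).symm

theorem adjoinRootEquiv_root : adjoinRootEquiv k (AdjoinRoot.root _) = quot k (X 0) := by
  rw [adjoinRootEquiv, AlgEquiv.symm_apply_eq]
  change _ = quotientFinSuccEquiv k (quot k (X 0))
  rw [quotientFinSuccEquiv_quot, finSuccEquiv_X_zero]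
  rfl

/-- The power basis `1, y₁, y₁²` of `R` over `k[y₂, y₃]`. -/
def nodePowerBasis : PowerBasis (MvPolynomial (Fin 2) k) (NodeRing k) :=
  (AdjoinRoot.powerBasis' (monic_monicCubic k)).map (adjoinRootEquiv k)

theorem nodePowerBasis_gen : (nodePowerBasis k).gen = quot k (X 0) := by
  simp [nodePowerBasis, adjoinRootEquiv_root]

theorem nodePowerBasis_dim : (nodePowerBasis k).dim = 3 := by
  simp [nodePowerBasis, natDegree_monicCubic]

instance instFiniteNodeRing : Module.Finite (MvPolynomial (Fin 2) k) (NodeRing k) :=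
  (nodePowerBasis k).finite

theorem rank_nodeRing : Module.rank (MvPolynomial (Fin 2) k) (NodeRing k) = 3 := by
  have h := rank_eq_card_basis (nodePowerBasis k).basis
  simpa [nodePowerBasis_dim] using h

theorem linearIndependent_pow :
    LinearIndependent (MvPolynomial (Fin 2) k) fun i : Fin 3 => quot k (X 0) ^ (i : ℕ) := by
  have h := (nodePowerBasis k).basis.linearIndependent
  have h2 := h.comp (Fin.cast (nodePowerBasis_dim k).symm) (Fin.cast_injective _)
  have he : (fun i : Fin 3 => quot k (X 0) ^ (i : ℕ)) =
      (nodePowerBasis k).basis ∘ Fin.cast (nodePowerBasis_dim k).symm := by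
    funext i
    simp [nodePowerBasis_gen]
  rw [he]
  exact h2

/-- Every nonzero element of `R` divides a nonzero element of `k[y₂, y₃]`. -/
theorem exists_mul_eq_algebraMap {r : NodeRing k} (hr : r ≠ 0) :
    ∃ (s : NodeRing k) (a : MvPolynomial (Fin 2) k), a ≠ 0 ∧ s * r = algebraMap _ _ a := by
  have h1 : Ideal.comap (algebraMap (MvPolynomial (Fin 2) k) (NodeRing k)) (Ideal.span {r}) ≠ ⊥ :=
    Ideal.comap_ne_bot_of_integral_mem hr (Ideal.mem_span_singleton_self r)
      (Algebra.IsIntegral.isIntegral r)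
  obtain ⟨a, ha, ha0⟩ := Submodule.exists_mem_ne_zero_of_ne_bot h1
  obtain ⟨s, hs⟩ := Ideal.mem_span_singleton'.1 (Ideal.mem_comap.1 ha)
  exact ⟨s, a, ha0, hs⟩

/-- The evaluation of `R` at the origin. -/
def evalZero : NodeRing k →+* k :=
  Ideal.Quotient.lift _ (eval (0 : Fin 3 → k)) (fun a ha => by
    obtain ⟨q, rfl⟩ := Ideal.mem_span_singleton.1 ha
    simp [cubic])

@[simp]
theorem evalZero_quot (p : MvPolynomial (Fin 3) k) : evalZero k (quot k p) = eval 0 p := rfl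

/-- The restriction of `R` to the line `y₁ = y₂ = 0`. -/
def evalLine : NodeRing k →+* Polynomial k :=
  Ideal.Quotient.lift _ (eval₂Hom Polynomial.C ![0, 0, Polynomial.X]) (fun a ha => by
    obtain ⟨q, rfl⟩ := Ideal.mem_span_singleton.1 ha
    simp [cubic])

theorem evalLine_quot_X (i : Fin 3) :
    evalLine k (quot k (X i)) = (![0, 0, Polynomial.X] : Fin 3 → Polynomial k) i := by
  simp [evalLine]

/-- The upper bound comes from dividing a three-dimensional domain by a nonzero element, the lower
one from the chain of primes 0 ⊂ (y₁, y₂) ⊂ (y₁, y₂, y₃), the last two realized as kernels of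
evaluations. -/
theorem ringKrullDim_nodeRing : ringKrullDim (NodeRing k) = 2 := by
  apply le_antisymm
  · have h1 : ringKrullDim (NodeRing k) + 1 ≤ ringKrullDim (MvPolynomial (Fin 3) k) :=
      ringKrullDim_quotient_succ_le_of_nonZeroDivisor
        (mem_nonZeroDivisors_of_ne_zero (prime_cubic k).ne_zero)
    rw [MvPolynomial.ringKrullDim_of_isNoetherianRing, ringKrullDim_eq_zero_of_field] at h1
    simp only [Nat.card_eq_fintype_card, Fintype.card_fin, zero_add] at h1
    have h2 : ringKrullDim (NodeRing k) + 1 ≤ 2 + 1 := by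
      refine h1.trans (le_of_eq ?_)
      norm_num
    exact ENat.WithBot.add_le_add_one_right_iff.1 h2
  · let p0 : PrimeSpectrum (NodeRing k) := ⟨⊥, Ideal.isPrime_bot⟩
    let p1 : PrimeSpectrum (NodeRing k) := ⟨RingHom.ker (evalLine k), RingHom.ker_isPrime _⟩
    let p2 : PrimeSpectrum (NodeRing k) := ⟨RingHom.ker (evalZero k), RingHom.ker_isPrime _⟩
    have h01 : p0 < p1 := by
      refine lt_of_le_of_ne (show (⊥ : Ideal _) ≤ _ from bot_le) (fun h => ?_)
      have hm : quot k (X 0) ∈ p1.asIdeal := by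
        change _ ∈ RingHom.ker _
        simp [RingHom.mem_ker, evalLine_quot_X]
      rw [← h] at hm
      exact not_cubic_dvd_X k 0 ((quot_eq_zero_iff k).1 hm)
    have h12 : p1 < p2 := by
      refine lt_of_le_of_ne (fun x hx => ?_) (fun h => ?_)
      · have hx' : evalLine k x = 0 := hx
        change evalZero k x = 0
        have hc : evalZero k = (Polynomial.evalRingHom 0).comp (evalLine k) := by
          apply Ideal.Quotient.ringHom_ext
          apply MvPolynomial.ringHom_ext
          · intro r
            simp [evalLine]
          · intro i
            fin_cases i <;> simp [evalLine]
        rw [hc, RingHom.comp_apply, hx', map_zero]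
      · have hm : quot k (X 2) ∈ p2.asIdeal := by
          change _ ∈ RingHom.ker _
          simp [RingHom.mem_ker]
        rw [← h] at hm
        have hm' : evalLine k (quot k (X 2)) = 0 := hm
        simp [evalLine_quot_X] at hm'
    exact Order.LTSeries.length_le_krullDim
      (RelSeries.fromListIsChain [p0, p1, p2] (by simp) (by simp [h01, h12]))

end Ring

/-! ### Homogeneous components indexed by integers. -/

section IntComponent

variable {σ : Type*} {k : Type u} [Field k]

/-- The homogeneous component of a polynomial in an integral degree, zero in negative degrees. -/
def intComponent (n : ℤ) : MvPolynomial σ k →ₗ[k] MvPolynomial σ k :=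
  if 0 ≤ n then homogeneousComponent n.toNat else 0

theorem intComponent_of_neg {n : ℤ} (hn : n < 0) (p : MvPolynomial σ k) :
    intComponent n p = 0 := by
  simp [intComponent, not_le.2 hn]

theorem intComponent_natCast (n : ℕ) (p : MvPolynomial σ k) :
    intComponent (n : ℤ) p = homogeneousComponent n p := by
  simp [intComponent]

theorem intComponent_of_isHomogeneous {m : ℕ} {p : MvPolynomial σ k} (hp : p.IsHomogeneous m)
    (n : ℤ) : intComponent n p = if n = m then p else 0 := by
  rcases lt_or_ge n 0 with hn | hn
  · rw [intComponent_of_neg hn, if_neg (by omega)]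
  · lift n to ℕ using hn
    rw [intComponent_natCast, homogeneousComponent_of_mem hp]
    norm_cast

theorem intComponent_intComponent (m n : ℤ) (p : MvPolynomial σ k) :
    intComponent m (intComponent n p) = if m = n then intComponent n p else 0 := by
  rcases lt_or_ge n 0 with hn | hn
  · simp [intComponent_of_neg hn]
  · lift n to ℕ using hn
    rw [intComponent_natCast,
      intComponent_of_isHomogeneous (homogeneousComponent_isHomogeneous n p)]

theorem sum_intComponent (p : MvPolynomial σ k) :
    ∑ i ∈ Finset.range (p.totalDegree + 1), intComponent (i : ℤ) p = p := by
  simp_rw [intComponent_natCast]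
  exact sum_homogeneousComponent p

/-- The integral index makes this hold also when n < m, where both sides vanish; degree shifts then
need no case distinctions. -/
theorem intComponent_mul {m : ℕ} {q : MvPolynomial σ k} (hq : q.IsHomogeneous m) (n : ℤ)
    (p : MvPolynomial σ k) : intComponent n (q * p) = q * intComponent (n - m) p := by
  conv_lhs => rw [← sum_intComponent p, Finset.mul_sum, map_sum]
  conv_rhs => rw [← sum_intComponent p, map_sum, Finset.mul_sum]
  refine Finset.sum_congr rfl fun i _ => ?_
  rw [intComponent_intComponent, intComponent_natCast,
    intComponent_of_isHomogeneous (hq.mul (homogeneousComponent_isHomogeneous i p))]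
  by_cases h : n = (m : ℤ) + i
  · rw [if_pos (by push_cast; exact h), if_pos (by omega)]
  · rw [if_neg (by push_cast; exact h), if_neg (by omega), mul_zero]

theorem intComponent_zero (p : MvPolynomial σ k) : intComponent 0 p = C (coeff 0 p) := by
  have := intComponent_natCast 0 p
  rw [homogeneousComponent_zero] at this
  exact_mod_cast this

end IntComponent

/-! ### The grading of R. -/

section RingDeg

variable {k : Type u} [Field k]

theorem quot_mem_ringDeg {p : MvPolynomial (Fin 3) k} {n : ℕ} (hp : p.IsHomogeneous n) :
    quot k p ∈ ringDeg k n :=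
  ⟨p, hp, rfl⟩

theorem quot_intComponent_mem_ringDeg (p : MvPolynomial (Fin 3) k) (n : ℤ) :
    quot k (intComponent n p) ∈ ringDeg k n := by
  rcases lt_or_ge n 0 with hn | hn
  · rw [intComponent_of_neg hn, map_zero]
    exact zero_mem _
  · lift n to ℕ using hn
    rw [intComponent_natCast]
    exact quot_mem_ringDeg (homogeneousComponent_isHomogeneous n p)

theorem exists_intComponent_of_mem_ringDeg {r : NodeRing k} {n : ℤ} (hr : r ∈ ringDeg k n) :
    ∃ p, intComponent n p = p ∧ quot k p = r := by
  rcases n with n | n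
  · obtain ⟨p, hp, rfl⟩ := hr
    refine ⟨p, ?_, rfl⟩
    exact (intComponent_natCast n p).trans (homogeneousComponent_eq_self hp)
  · refine ⟨0, map_zero _, ?_⟩
    rw [map_zero]
    exact (AddSubgroup.mem_bot.1 hr).symm

theorem mul_mem_ringDeg {m n : ℤ} {r s : NodeRing k} (hr : r ∈ ringDeg k m)
    (hs : s ∈ ringDeg k n) : r * s ∈ ringDeg k (m + n) := by
  obtain ⟨p, hp, rfl⟩ := exists_intComponent_of_mem_ringDeg hr
  obtain ⟨q, hq, rfl⟩ := exists_intComponent_of_mem_ringDeg hs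
  rcases lt_or_ge m 0 with hm | hm
  · rw [← hp, intComponent_of_neg hm, map_zero, zero_mul]
    exact zero_mem _
  · lift m to ℕ using hm
    have hp' : p.IsHomogeneous m := by
      rw [← hp, intComponent_natCast]
      exact homogeneousComponent_isHomogeneous m p
    have : intComponent (m + n) (p * q) = p * q := by
      rw [intComponent_mul hp', add_sub_cancel_left, hq]
    rw [← map_mul, ← this]
    exact quot_intComponent_mem_ringDeg _ _

end RingDeg

/-! ### The matrix factorization and its exactness. -/

section Alpha

variable {k : Type u} [Field k] {a b : k}

/-- For arbitrary a, b the determinant is f + (b² - a³ - a²) y₃³. -/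
theorem det_alpha (h : b ^ 2 = a ^ 3 + a ^ 2) : (alpha a b).det = cubic k := by
  have hC : (C b : MvPolynomial (Fin 3) k) ^ 2 = C a ^ 3 + C a ^ 2 := by
    rw [← C_pow, h, C_add, C_pow, C_pow]
  rw [Matrix.det_fin_three]
  simp only [alpha, cubic, Matrix.of_apply, Matrix.cons_val', Matrix.cons_val_zero,
    Matrix.cons_val_one, Matrix.cons_val, C_add, C_pow, C_1]
  linear_combination (X 2 ^ 3) * hC

theorem alpha_mul_beta (h : b ^ 2 = a ^ 3 + a ^ 2) :
    alpha a b * beta a b = cubic k • (1 : Matrix (Fin 3) (Fin 3) (MvPolynomial (Fin 3) k)) := by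
  rw [beta, Matrix.mul_adjugate, det_alpha h]

theorem beta_mul_alpha (h : b ^ 2 = a ^ 3 + a ^ 2) :
    beta a b * alpha a b = cubic k • (1 : Matrix (Fin 3) (Fin 3) (MvPolynomial (Fin 3) k)) := by
  rw [beta, Matrix.adjugate_mul, det_alpha h]

theorem isHomogeneous_alpha (a b : k) (i j : Fin 3) : (alpha a b i j).IsHomogeneous 1 := by
  have h0 := isHomogeneous_X k (0 : Fin 3)
  have h1 := isHomogeneous_X k (1 : Fin 3)
  have h2 := fun c : k => isHomogeneous_C_mul_X c (2 : Fin 3)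
  have hz := isHomogeneous_zero (Fin 3) k 1
  fin_cases i <;> fin_cases j
  · exact hz
  · exact h0.sub (h2 a)
  · exact h1.sub (h2 b)
  · exact h0
  · exact h1.add (h2 b)
  · exact h2 (a ^ 2 + a)
  · exact isHomogeneous_X k 2
  · exact hz
  · exact h0.neg.sub (h2 (a + 1))

theorem isHomogeneous_adjugate {A : Matrix (Fin 3) (Fin 3) (MvPolynomial (Fin 3) k)}
    (hA : ∀ i j, (A i j).IsHomogeneous 1) (i j : Fin 3) : (A.adjugate i j).IsHomogeneous 2 := by
  have hm : ∀ i j l m : Fin 3, (A i j * A l m).IsHomogeneous 2 :=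
    fun i j l m => (hA i j).mul (hA l m)
  rw [Matrix.adjugate_fin_three]
  fin_cases i <;> fin_cases j
  · exact (hm 1 1 2 2).sub (hm 1 2 2 1)
  · exact (hm 0 1 2 2).neg.add (hm 0 2 2 1)
  · exact (hm 0 1 1 2).sub (hm 0 2 1 1)
  · exact (hm 1 0 2 2).neg.add (hm 1 2 2 0)
  · exact (hm 0 0 2 2).sub (hm 0 2 2 0)
  · exact (hm 0 0 1 2).neg.add (hm 0 2 1 0)
  · exact (hm 1 0 2 1).sub (hm 1 1 2 0)
  · exact (hm 0 0 2 1).neg.add (hm 0 1 2 0)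
  · exact (hm 0 0 1 1).sub (hm 0 1 1 0)

theorem isHomogeneous_beta (a b : k) (i j : Fin 3) : (beta a b i j).IsHomogeneous 2 :=
  isHomogeneous_adjugate (isHomogeneous_alpha a b) i j

theorem isMatrixFactorization_alpha (h : b ^ 2 = a ^ 3 + a ^ 2) :
    IsMatrixFactorization (cubic k) (alpha a b) (beta a b) :=
  ⟨fun i j => ⟨1, isHomogeneous_alpha a b i j⟩, fun i j => ⟨2, isHomogeneous_beta a b i j⟩,
    alpha_mul_beta h, beta_mul_alpha h⟩

theorem alpha_mulVec_beta (h : b ^ 2 = a ^ 3 + a ^ 2) (x : Fin 3 → MvPolynomial (Fin 3) k) :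
    (alpha a b).mulVec ((beta a b).mulVec x) = cubic k • x := by
  rw [Matrix.mulVec_mulVec, alpha_mul_beta h, Matrix.smul_mulVec, Matrix.one_mulVec]

theorem beta_mulVec_alpha (h : b ^ 2 = a ^ 3 + a ^ 2) (x : Fin 3 → MvPolynomial (Fin 3) k) :
    (beta a b).mulVec ((alpha a b).mulVec x) = cubic k • x := by
  rw [Matrix.mulVec_mulVec, beta_mul_alpha h, Matrix.smul_mulVec, Matrix.one_mulVec]

theorem smul_cubic_cancel {x y : Fin 3 → MvPolynomial (Fin 3) k}
    (h : cubic k • x = cubic k • y) : x = y :=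
  smul_right_injective _ (prime_cubic k).ne_zero h

theorem exists_eq_cubic_smul {x : Fin 3 → MvPolynomial (Fin 3) k} (h : ∀ i, cubic k ∣ x i) :
    ∃ w, x = cubic k • w := by
  choose w hw using h
  exact ⟨w, funext hw⟩

/-- A vector is in the image of `α` as soon as `β` maps it to a multiple of the cubic. -/
theorem exists_eq_alpha_mulVec (h : b ^ 2 = a ^ 3 + a ^ 2) {x : Fin 3 → MvPolynomial (Fin 3) k}
    (hx : ∀ i, cubic k ∣ (beta a b).mulVec x i) : ∃ w, x = (alpha a b).mulVec w := by
  obtain ⟨w, hw⟩ := exists_eq_cubic_smul hx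
  refine ⟨w, smul_cubic_cancel ?_⟩
  rw [← alpha_mulVec_beta h, hw, Matrix.mulVec_smul]

theorem exists_eq_beta_mulVec (h : b ^ 2 = a ^ 3 + a ^ 2) {x : Fin 3 → MvPolynomial (Fin 3) k}
    (hx : ∀ i, cubic k ∣ (alpha a b).mulVec x i) : ∃ w, x = (beta a b).mulVec w := by
  obtain ⟨w, hw⟩ := exists_eq_cubic_smul hx
  refine ⟨w, smul_cubic_cancel ?_⟩
  rw [← beta_mulVec_alpha h, hw, Matrix.mulVec_smul]

theorem exists_eq_alpha_mulVec_of_smul (h : b ^ 2 = a ^ 3 + a ^ 2) {p : MvPolynomial (Fin 3) k}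
    (hp : ¬ cubic k ∣ p) {x w : Fin 3 → MvPolynomial (Fin 3) k}
    (hx : p • x = (alpha a b).mulVec w) : ∃ w, x = (alpha a b).mulVec w := by
  refine exists_eq_alpha_mulVec h fun i => ?_
  have h1 := congrFun (congrArg (beta a b).mulVec hx) i
  rw [Matrix.mulVec_smul, beta_mulVec_alpha h] at h1
  exact ((prime_cubic k).dvd_or_dvd (Dvd.intro _ h1.symm)).resolve_left hp

/-- `y₂` is a nonzerodivisor modulo `f` and `y₃`. -/
theorem exists_eq_of_X_mul {v w z : MvPolynomial (Fin 3) k}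
    (h : X 1 * v = X 2 * z + cubic k * w) : ∃ u t, v = cubic k * u + X 2 * t := by
  let φ : MvPolynomial (Fin 3) k →ₐ[k] MvPolynomial (Fin 3) k := aeval ![X 0, X 1, 0]
  have hφ : ∀ p, X 2 ∣ p - φ p := by
    intro p
    induction p using MvPolynomial.induction_on with
    | C r => simp [φ]
    | add p q hp hq =>
      rw [map_add, add_sub_add_comm]
      exact dvd_add hp hq
    | mul_X p i hp =>
      have hi : (X 2 : MvPolynomial (Fin 3) k) ∣ X i - φ (X i) := by
        fin_cases i <;> simp [φ]
      have : p * X i - φ (p * X i) = (p - φ p) * X i + φ p * (X i - φ (X i)) := by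
        rw [map_mul]; ring
      rw [this]
      exact dvd_add (hp.mul_right _) (hi.mul_left _)
  have hf : φ (cubic k) = X 0 ^ 3 := by simp [φ, cubic]
  have h1 : X 1 * φ v = X 0 ^ 3 * φ w := by
    have := congrArg φ h
    rw [map_add, map_mul, map_mul, map_mul, hf] at this
    simpa [φ] using this
  have hX1 : Prime (X 1 : MvPolynomial (Fin 3) k) := X_prime
  have h2 : X 1 ∣ φ w := by
    refine (hX1.dvd_or_dvd (Dvd.intro _ h1)).resolve_left fun hd => ?_
    have := hX1.dvd_of_dvd_pow hd
    rw [X_dvd_X] at this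
    simp at this
  obtain ⟨u, hu⟩ := h2
  have h3 : φ v = X 0 ^ 3 * u := by
    apply mul_left_cancel₀ hX1.ne_zero
    rw [h1, hu]; ring
  obtain ⟨t, ht⟩ := hφ v
  -- Modulo y₃ the cubic is y₁³; the correction to t is the rest of f u, since f = y₁³ + y₃ (y₁² -
  -- y₂²).
  refine ⟨u, t - (X 0 ^ 2 - X 1 ^ 2) * u, ?_⟩
  rw [h3] at ht
  simp only [cubic]
  linear_combination ht

/-- Regularity of y₂ on the cokernel modulo y₃. Applying β reduces to the scalar statement and gives
βx = f u + y₃ t. Applying α shows that f divides y₃ αt, hence αt, so t = βs, and f can be cancelled.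
-/
theorem exists_eq_of_X_smul (h : b ^ 2 = a ^ 3 + a ^ 2) {x z w : Fin 3 → MvPolynomial (Fin 3) k}
    (hx : (X 1 : MvPolynomial (Fin 3) k) • x = (X 2 : MvPolynomial (Fin 3) k) • z +
      (alpha a b).mulVec w) :
    ∃ s u, x = (X 2 : MvPolynomial (Fin 3) k) • s + (alpha a b).mulVec u := by
  have h1 : ∀ i, ∃ u t, (beta a b).mulVec x i = cubic k * u + X 2 * t := by
    intro i
    have h1 := congrFun (congrArg (beta a b).mulVec hx) i
    rw [Matrix.mulVec_smul, Matrix.mulVec_add, Matrix.mulVec_smul, beta_mulVec_alpha h] at h1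
    exact exists_eq_of_X_mul h1
  choose u t hut using h1
  have h2 : (beta a b).mulVec x = cubic k • u + (X 2 : MvPolynomial (Fin 3) k) • t :=
    funext hut
  have h3 := congrArg (alpha a b).mulVec h2
  rw [alpha_mulVec_beta h, Matrix.mulVec_add, Matrix.mulVec_smul, Matrix.mulVec_smul] at h3
  obtain ⟨s, rfl⟩ : ∃ s, t = (beta a b).mulVec s := by
    refine exists_eq_beta_mulVec h fun i => ?_
    have h4 : X 2 * (alpha a b).mulVec t i = cubic k * (x i - (alpha a b).mulVec u i) := by
      have := congrFun h3 i
      simp only [Pi.add_apply, Pi.smul_apply, smul_eq_mul] at this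
      linear_combination -this
    exact ((prime_cubic k).dvd_or_dvd (Dvd.intro _ h4.symm)).resolve_left (not_cubic_dvd_X k 2)
  refine ⟨s, u, smul_cubic_cancel ?_⟩
  rw [h3, alpha_mulVec_beta h, smul_add, smul_comm, add_comm]

end Alpha

theorem isWeaklyRegular_pair_iff {R M : Type*} [CommRing R] [AddCommGroup M] [Module R M]
    (r s : R) : RingTheory.Sequence.IsWeaklyRegular M [r, s] ↔
      (∀ m : M, r • m = 0 → m = 0) ∧
        ∀ m m' : M, s • m = r • m' → ∃ m'' : M, m = r • m'' := by
  rw [RingTheory.Sequence.isWeaklyRegular_cons_iff,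
    RingTheory.Sequence.isWeaklyRegular_singleton_iff, isSMulRegular_iff_right_eq_zero_of_smul,
    isSMulRegular_quotient_iff_mem_of_smul_mem]
  simp only [Submodule.mem_smul_pointwise_iff_exists, Submodule.mem_top, true_and]
  refine and_congr_right fun _ => ⟨fun h m m' hm => ?_, fun h m hm => ?_⟩
  · obtain ⟨x, hx⟩ := h m ⟨m', hm.symm⟩
    exact ⟨x, hx.symm⟩
  · obtain ⟨m', hm'⟩ := hm
    obtain ⟨x, hx⟩ := h m m' hm'.symm
    exact ⟨x, hx.symm⟩

/-! ### The cokernels: generators, grading, depth and rank. -/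

section Coker

variable {k : Type u} [Field k]

section General

variable {A : Matrix (Fin 3) (Fin 3) (MvPolynomial (Fin 3) k)}

/-- The class in `Coker A` of a vector of polynomials. -/
def cokerMk (A : Matrix (Fin 3) (Fin 3) (MvPolynomial (Fin 3) k)) :
    (Fin 3 → MvPolynomial (Fin 3) k) →+ Coker A :=
  (LinearMap.range (Matrix.mulVecLin (A.map (quot k)))).mkQ.toAddMonoidHom.comp
    ((quot k).toAddMonoidHom.compLeft (Fin 3))

theorem cokerMk_apply (x : Fin 3 → MvPolynomial (Fin 3) k) :
    cokerMk A x = Submodule.Quotient.mk (fun i => quot k (x i)) := rfl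

theorem exists_lift (x : Fin 3 → NodeRing k) :
    ∃ y : Fin 3 → MvPolynomial (Fin 3) k, (fun i => quot k (y i)) = x := by
  choose y hy using fun i => Ideal.Quotient.mk_surjective (x i)
  exact ⟨y, funext hy⟩

theorem cokerMk_surjective : Function.Surjective (cokerMk A) := by
  intro x
  obtain ⟨x, rfl⟩ := Submodule.Quotient.mk_surjective _ x
  obtain ⟨y, rfl⟩ := exists_lift x
  exact ⟨y, rfl⟩

theorem quot_smul_cokerMk (p : MvPolynomial (Fin 3) k) (x : Fin 3 → MvPolynomial (Fin 3) k) :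
    quot k p • cokerMk A x = cokerMk A (p • x) := by
  rw [cokerMk_apply, cokerMk_apply, ← Submodule.Quotient.mk_smul]
  congr 1

theorem map_quot_mulVec (x : Fin 3 → MvPolynomial (Fin 3) k) :
    (A.map (quot k)).mulVec (fun i => quot k (x i)) = fun i => quot k (A.mulVec x i) := by
  ext i
  exact (RingHom.map_mulVec (quot k) A x i).symm

/-- A linear map out of the cokernel of a matrix is given by a linear map that vanishes on the
columns. -/
theorem range_le_ker {N : Type*} [AddCommGroup N] [Module (NodeRing k) N]
    (φ : (Fin 3 → NodeRing k) →ₗ[NodeRing k] N)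
    (h : ∀ j, φ (fun i => quot k (A i j)) = 0) :
    LinearMap.range (Matrix.mulVecLin (A.map (quot k))) ≤ LinearMap.ker φ := by
  rw [Matrix.range_mulVecLin, Submodule.span_le]
  rintro _ ⟨j, rfl⟩
  exact h j

/-- The reduction of the cokernel of a matrix of linear forms modulo the irrelevant ideal. -/
def cokerEvalZero (hA : ∀ i j, (A i j).IsHomogeneous 1) : Coker A →ₛₗ[evalZero k] (Fin 3 → k) :=
  Submodule.liftQ _
    { toFun := fun x i => evalZero k (x i)
      map_add' := fun x y => by ext i; simp
      map_smul' := fun r x => by ext i; simp }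
    (by
      rw [Matrix.range_mulVecLin, Submodule.span_le]
      rintro _ ⟨j, rfl⟩
      ext i
      have : eval 0 (A i j) = 0 := by
        rw [eval_zero, constantCoeff_eq]
        exact (hA i j).coeff_eq_zero (by simp)
      exact this)

theorem cokerEvalZero_mk (hA : ∀ i j, (A i j).IsHomogeneous 1) (x : Fin 3 → NodeRing k)
    (i : Fin 3) : cokerEvalZero hA (Submodule.Quotient.mk x) i = evalZero k (x i) := rfl

instance instRingHomSurjectiveEvalZero : RingHomSurjective (evalZero k) :=
  ⟨fun r => ⟨quot k (C r), by simp⟩⟩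

theorem cokerEvalZero_surjective (hA : ∀ i j, (A i j).IsHomogeneous 1) :
    Function.Surjective (cokerEvalZero hA) := by
  intro x
  refine ⟨Submodule.Quotient.mk fun i => quot k (C (x i)), ?_⟩
  ext i
  simp [cokerEvalZero_mk]

/-- Linear entries vanish at the origin, so reduction modulo the irrelevant ideal still maps onto
k³, and fewer than three generators cannot suffice. -/
theorem isMinimallyGenerated_coker (hA : ∀ i j, (A i j).IsHomogeneous 1) :
    IsMinimallyGenerated k (Coker A) 3 := by
  apply le_antisymm
  · have h1 := Submodule.spanRank_range_le
      (LinearMap.range (Matrix.mulVecLin (A.map (quot k)))).mkQ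
    rw [Submodule.range_mkQ] at h1
    refine h1.trans (le_of_eq ?_)
    rw [← Submodule.rank_eq_spanRank_of_free, rank_fun']
    simp
  · have h1 := Submodule.spanRank_range_le (cokerEvalZero hA)
    rw [LinearMap.range_eq_top.2 (cokerEvalZero_surjective hA),
      ← Submodule.rank_eq_spanRank_of_free, rank_fun'] at h1
    simpa using h1

theorem cokerMk_mem_cokerDeg (x : Fin 3 → MvPolynomial (Fin 3) k) (j : ℤ) :
    cokerMk A (fun i => intComponent (j - 1) (x i)) ∈ cokerDeg A j :=
  ⟨fun i => quot k (intComponent (j - 1) (x i)),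
    fun i _ => quot_intComponent_mem_ringDeg (x i) (j - 1), rfl⟩

theorem exists_cokerMk_of_mem_cokerDeg {x : Coker A} {j : ℤ} (hx : x ∈ cokerDeg A j) :
    ∃ y : Fin 3 → MvPolynomial (Fin 3) k,
      (∀ i, intComponent (j - 1) (y i) = y i) ∧ cokerMk A y = x := by
  obtain ⟨z, hz, rfl⟩ := hx
  choose y hy hyz using fun i => exists_intComponent_of_mem_ringDeg (hz i trivial)
  refine ⟨y, hy, ?_⟩
  rw [cokerMk_apply, show (fun i => quot k (y i)) = z from funext hyz]
  rfl

theorem intComponent_mulVec (hA : ∀ i j, (A i j).IsHomogeneous 1)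
    (w : Fin 3 → MvPolynomial (Fin 3) k) (n : ℤ) (i : Fin 3) :
    intComponent n (A.mulVec w i) = A.mulVec (fun j => intComponent (n - 1) (w j)) i := by
  simp only [Matrix.mulVec, dotProduct, map_sum]
  refine Finset.sum_congr rfl fun j _ => ?_
  rw [intComponent_mul (hA i j)]
  simp

/-- The hypothesis `h0` says that the image of A over S already contains f S³; sums and components
can then be handled with polynomial vectors instead of classes in R. -/
theorem isGraded_cokerDeg (hA : ∀ i j, (A i j).IsHomogeneous 1)
    (h0 : ∀ x, cokerMk A x = 0 ↔ ∃ w, x = A.mulVec w) :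
    IsGraded (k := k) (cokerDeg A) := by
  classical
  refine ⟨⟨?_, ?_⟩, ?_⟩
  · rw [injective_iff_map_eq_zero]
    intro x hx
    choose y hy hyx using fun j => exists_cokerMk_of_mem_cokerDeg (x j).2
    rw [DirectSum.coeAddMonoidHom_eq_dfinsuppSum, DFinsupp.sum] at hx
    simp_rw [← hyx] at hx
    rw [← map_sum, h0] at hx
    obtain ⟨w, hw⟩ := hx
    ext n
    by_cases hn : n ∈ DFinsupp.support x
    -- The component of degree n - 1 isolates the summand y n; as A is linear, it is the image of a
    -- component of w one degree lower.
    · have h1 : y n = A.mulVec (fun j => intComponent (n - 1 - 1) (w j)) := by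
        ext1 i
        rw [← intComponent_mulVec hA w (n - 1) i, ← hw, Finset.sum_apply, map_sum,
          Finset.sum_eq_single n]
        · exact (hy n i).symm
        · intro m _ hm
          rw [← hy m i, intComponent_intComponent, if_neg (by omega)]
        · exact fun h => absurd hn h
      rw [← hyx n, (h0 _).2 ⟨_, h1⟩]
      rfl
    · rw [DFinsupp.notMem_support_iff.1 hn]
      rfl
  · intro x
    rw [← AddMonoidHom.mem_range]
    obtain ⟨y, rfl⟩ := cokerMk_surjective x
    let N := (Finset.univ.sup fun i => (y i).totalDegree) + 1
    have hy : y = ∑ n ∈ Finset.range N, fun i => intComponent (n : ℤ) (y i) := by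
      ext1 i
      rw [Finset.sum_apply]
      conv_lhs => rw [← sum_intComponent (y i)]
      refine Finset.sum_subset ?_ ?_
      · intro n hn
        have := Finset.le_sup (f := fun i => (y i).totalDegree) (Finset.mem_univ i)
        simp only [Finset.mem_range, N] at hn ⊢
        omega
      · intro n _ hn
        rw [intComponent_natCast, homogeneousComponent_eq_zero]
        simp only [Finset.mem_range] at hn
        omega
    rw [hy, map_sum]
    refine sum_mem fun n _ => ?_
    have hm : cokerMk A (fun i => intComponent (n : ℤ) (y i)) ∈ cokerDeg A (n + 1) := by
      have := cokerMk_mem_cokerDeg (A := A) y (n + 1)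
      rwa [add_sub_cancel_right] at this
    exact ⟨DirectSum.of (fun j => cokerDeg A j) (n + 1) ⟨_, hm⟩,
      DirectSum.coeAddMonoidHom_of _ _ _⟩
  · rintro i j r m hr ⟨x, hx, rfl⟩
    refine ⟨r • x, fun l _ => ?_, LinearMap.map_smul (Submodule.mkQ _) r x⟩
    rw [show i + j - 1 = i + (j - 1) by ring]
    exact mul_mem_ringDeg hr (hx l trivial)

end General

section Alpha

variable {a b : k}

theorem cokerMk_alpha_eq_zero_iff (h : b ^ 2 = a ^ 3 + a ^ 2)
    (x : Fin 3 → MvPolynomial (Fin 3) k) :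
    cokerMk (alpha a b) x = 0 ↔ ∃ w, x = (alpha a b).mulVec w := by
  rw [cokerMk_apply, Submodule.Quotient.mk_eq_zero, LinearMap.mem_range]
  constructor
  · rintro ⟨w, hw⟩
    obtain ⟨w, rfl⟩ := exists_lift w
    rw [Matrix.mulVecLin_apply, map_quot_mulVec] at hw
    have h1 : ∀ i, cubic k ∣ x i - (alpha a b).mulVec w i := by
      intro i
      rw [← quot_eq_zero_iff, map_sub, sub_eq_zero]
      exact (congrFun hw i).symm
    obtain ⟨z, hz⟩ := exists_eq_cubic_smul (x := x - (alpha a b).mulVec w) h1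
    refine ⟨w + (beta a b).mulVec z, ?_⟩
    rw [Matrix.mulVec_add, alpha_mulVec_beta h, ← hz]
    abel
  · rintro ⟨w, rfl⟩
    exact ⟨fun i => quot k (w i), by rw [Matrix.mulVecLin_apply, map_quot_mulVec]⟩

theorem isGraded_cokerDeg_alpha (h : b ^ 2 = a ^ 3 + a ^ 2) :
    IsGraded (k := k) (cokerDeg (alpha a b)) :=
  isGraded_cokerDeg (isHomogeneous_alpha a b) (cokerMk_alpha_eq_zero_iff h)

theorem coker_alpha_smul_eq_zero (h : b ^ 2 = a ^ 3 + a ^ 2) {r : NodeRing k} (hr : r ≠ 0)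
    {x : Coker (alpha a b)} (hx : r • x = 0) : x = 0 := by
  obtain ⟨p, rfl⟩ := Ideal.Quotient.mk_surjective r
  obtain ⟨y, rfl⟩ := cokerMk_surjective x
  rw [quot_smul_cokerMk, cokerMk_alpha_eq_zero_iff h] at hx
  obtain ⟨w, hw⟩ := hx
  rw [Ne, quot_eq_zero_iff] at hr
  rw [cokerMk_alpha_eq_zero_iff h]
  exact exists_eq_alpha_mulVec_of_smul h hr hw

theorem isRegular_coker_alpha (h : b ^ 2 = a ^ 3 + a ^ 2) :
    RingTheory.Sequence.IsRegular (Coker (alpha a b)) [quot k (X 2), quot k (X 1)] := by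
  refine ⟨(isWeaklyRegular_pair_iff _ _).2 ⟨fun m hm => ?_, fun m m' hm => ?_⟩, fun ht => ?_⟩
  · exact coker_alpha_smul_eq_zero h (fun h2 => not_cubic_dvd_X k 2 ((quot_eq_zero_iff k).1 h2)) hm
  · obtain ⟨x, rfl⟩ := cokerMk_surjective m
    obtain ⟨z, rfl⟩ := cokerMk_surjective m'
    rw [quot_smul_cokerMk, quot_smul_cokerMk, ← sub_eq_zero, ← map_sub,
      cokerMk_alpha_eq_zero_iff h] at hm
    obtain ⟨w, hw⟩ := hm
    obtain ⟨s, u, rfl⟩ := exists_eq_of_X_smul h (sub_eq_iff_eq_add'.1 hw)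
    refine ⟨cokerMk _ s, ?_⟩
    rw [quot_smul_cokerMk, map_add, (cokerMk_alpha_eq_zero_iff h _).2 ⟨u, rfl⟩, add_zero]
  · have hA := isHomogeneous_alpha a b
    -- If y₃ and y₂ generated all of the module, the surjection onto k³ would be zero.
    have h1 : (⊤ : Submodule (NodeRing k) (Coker (alpha a b))) ≤ LinearMap.ker (cokerEvalZero hA) := by
      rw [ht, Submodule.smul_le]
      intro r hr n _
      have hr0 : evalZero k r = 0 := by
        have : Ideal.ofList [quot k (X 2), quot k (X 1)] ≤ RingHom.ker (evalZero k) := by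
          rw [Ideal.ofList, Ideal.span_le]
          intro x hx
          simp only [List.mem_cons, List.not_mem_nil, or_false, Set.mem_ofPred_eq] at hx
          rcases hx with rfl | rfl <;> simp [RingHom.mem_ker]
        exact this hr
      rw [LinearMap.mem_ker, map_smulₛₗ, hr0, zero_smul]
    obtain ⟨x, hx⟩ := cokerEvalZero_surjective hA 1
    have h2 := LinearMap.mem_ker.1 (h1 (Submodule.mem_top (x := x)))
    rw [hx] at h2
    exact one_ne_zero h2

theorem isGradedMCM_coker_alpha (h : b ^ 2 = a ^ 3 + a ^ 2) :
    IsGradedMCM (k := k) (cokerDeg (alpha a b)) := by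
  refine ⟨inferInstance, isGraded_cokerDeg_alpha h, [quot k (X 2), quot k (X 1)], ?_, ?_,
    isRegular_coker_alpha h⟩
  · intro r hr
    simp only [List.mem_cons, List.not_mem_nil, or_false] at hr
    rcases hr with rfl | rfl
    · exact Ideal.subset_span ⟨2, rfl⟩
    · exact Ideal.subset_span ⟨1, rfl⟩
  · rw [ringKrullDim_nodeRing]
    rfl

/-- The embedding of the cokernel of `α` into `R` by the last row of `β`. -/
def cokerToRing (h : b ^ 2 = a ^ 3 + a ^ 2) : Coker (alpha a b) →ₗ[NodeRing k] NodeRing k :=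
  Submodule.liftQ _ (LinearMap.proj 2 ∘ₗ Matrix.mulVecLin ((beta a b).map (quot k)))
    (range_le_ker _ fun j => by
      have h1 : (alpha a b).mulVec (Pi.single j 1) = fun i => alpha a b i j := by
        rw [Matrix.mulVec_single_one]; rfl
      have h2 := beta_mulVec_alpha h (Pi.single j 1)
      rw [h1] at h2
      rw [LinearMap.comp_apply, Matrix.mulVecLin_apply, map_quot_mulVec, h2, LinearMap.proj_apply,
        quot_eq_zero_iff]
      exact Dvd.intro _ rfl)

theorem cokerToRing_cokerMk (h : b ^ 2 = a ^ 3 + a ^ 2) (x : Fin 3 → MvPolynomial (Fin 3) k) :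
    cokerToRing h (cokerMk (alpha a b) x) = quot k ((beta a b).mulVec x 2) :=
  congrFun (map_quot_mulVec (A := beta a b) x) 2

/-- Put y = βx, so that αy = f x. If f divides the last entry of y, the third row of α gives f ∣ y₃
· y 0 and the first row gives f ∣ (y₁ - a y₃) · y 1. Since f is prime and divides no nonzero linear
form, it divides all of y. -/
theorem cokerToRing_injective (h : b ^ 2 = a ^ 3 + a ^ 2) :
    Function.Injective (cokerToRing h) := by
  rw [injective_iff_map_eq_zero]
  intro x hx
  obtain ⟨x, rfl⟩ := cokerMk_surjective x
  rw [cokerToRing_cokerMk, quot_eq_zero_iff] at hx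
  rw [cokerMk_alpha_eq_zero_iff h]
  refine exists_eq_alpha_mulVec h ?_
  set y := (beta a b).mulVec x with hy
  have hα := alpha_mulVec_beta h x
  rw [← hy] at hα
  have hf := prime_cubic k
  have e0 := congrFun hα 0
  have e2 := congrFun hα 2
  simp only [alpha, Matrix.mulVec, dotProduct, Fin.sum_univ_three, Matrix.of_apply,
    Matrix.cons_val', Matrix.cons_val_zero, Matrix.cons_val_one, Matrix.cons_val, Pi.smul_apply,
    smul_eq_mul, zero_mul, zero_add, add_zero] at e0 e2
  have hl : ¬ cubic k ∣ X 0 - C a * X 2 := by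
    refine not_cubic_dvd k ((isHomogeneous_X k 0).sub (isHomogeneous_C_mul_X a 2)) (fun h0 => ?_)
      (by norm_num)
    have := congrArg (eval ![1, 0, 0]) h0
    simp at this
  rw [Fin.forall_fin_succ, Fin.forall_fin_two]
  refine ⟨?_, ?_, hx⟩
  · refine (hf.dvd_or_dvd (a := X 2) ?_).resolve_left (not_cubic_dvd_X k 2)
    rw [← (dvd_add_left (hx.mul_left (-X 0 - C (a + 1) * X 2))), e2]
    exact Dvd.intro _ rfl
  · change cubic k ∣ y 1
    refine (hf.dvd_or_dvd (a := X 0 - C a * X 2) ?_).resolve_left hl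
    rw [← (dvd_add_left (hx.mul_left (X 1 - C b * X 2))), e0]
    exact Dvd.intro _ rfl

theorem rank_coker_alpha (h : b ^ 2 = a ^ 3 + a ^ 2) :
    Module.rank (NodeRing k) (Coker (alpha a b)) = 1 := by
  apply le_antisymm
  · have := LinearMap.rank_le_of_injective _ (cokerToRing_injective h)
    rwa [Module.rank_self] at this
  · obtain ⟨x, hx⟩ := cokerEvalZero_surjective (isHomogeneous_alpha a b) 1
    have hx0 : x ≠ 0 := by
      rintro rfl
      rw [map_zero] at hx
      exact zero_ne_one hx
    rw [Cardinal.one_le_iff_ne_zero]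
    intro h0
    rw [rank_eq_zero_iff] at h0
    obtain ⟨r, hr, hrx⟩ := h0 x
    exact hx0 (coker_alpha_smul_eq_zero h hr hrx)

end Alpha

end Coker

/-! ### Linear parts of homomorphisms; distinct points give non-isomorphic modules. -/

section Tangent

variable {k : Type u} [Field k]

/-- The ring homomorphism from `R` to the dual numbers given by the tangent vector `v` at the
origin. -/
def tangent (v : Fin 3 → k) : NodeRing k →+* DualNumber k :=
  Ideal.Quotient.lift _ (eval₂Hom (TrivSqZeroExt.inlHom k k) fun i => TrivSqZeroExt.inr (v i))
    (fun p hp => by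
      obtain ⟨q, rfl⟩ := Ideal.mem_span_singleton.1 hp
      have h : ∀ x y z : k, (TrivSqZeroExt.inr x * TrivSqZeroExt.inr y * TrivSqZeroExt.inr z :
          DualNumber k) = 0 := by
        intro x y z
        rw [TrivSqZeroExt.inr_mul_inr, zero_mul]
      simp only [cubic, map_mul, map_add, map_sub, coe_eval₂Hom, eval₂_X, pow_succ,
        pow_zero, one_mul, h, zero_mul, add_zero, sub_zero])

theorem fst_tangent (v : Fin 3 → k) (r : NodeRing k) : (tangent v r).fst = evalZero k r := by
  have : (TrivSqZeroExt.fstHom k k k).toRingHom.comp (tangent v) = evalZero k := by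
    apply Ideal.Quotient.ringHom_ext
    apply MvPolynomial.ringHom_ext
    · intro r
      simp [tangent]
    · intro i
      simp [tangent]
  exact RingHom.congr_fun this r

theorem snd_tangent_mul (v : Fin 3 → k) (r s : NodeRing k) :
    (tangent v (r * s)).snd = evalZero k r * (tangent v s).snd + evalZero k s * (tangent v r).snd := by
  rw [map_mul, TrivSqZeroExt.snd_mul, fst_tangent, fst_tangent]
  simp [mul_comm]

theorem snd_tangent_quot {p : MvPolynomial (Fin 3) k} (hp : p.IsHomogeneous 1) (v : Fin 3 → k) :
    (tangent v (quot k p)).snd = eval v p := by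
  have hp' : p ∈ homogeneousSubmodule (Fin 3) k 1 := hp
  rw [homogeneousSubmodule_one_eq_span_X] at hp'
  clear hp
  induction hp' using Submodule.span_induction with
  | mem x hx =>
    obtain ⟨i, rfl⟩ := hx
    simp [tangent]
  | zero => simp
  | add x y _ _ hx hy => rw [map_add, map_add, TrivSqZeroExt.snd_add, hx, hy, map_add]
  | smul c x _ hx =>
    rw [smul_eq_C_mul, map_mul (quot k), snd_tangent_mul, hx]
    simp [tangent]

/-- A homomorphism between cokernels of matrices of linear forms induces an equivalence of the
constant coefficient matrices, as far as it is invertible. -/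
theorem exists_matrix_of_linearMap {A B : Matrix (Fin 3) (Fin 3) (MvPolynomial (Fin 3) k)}
    (hA : ∀ i j, (A i j).IsHomogeneous 1) (hB : ∀ i j, (B i j).IsHomogeneous 1)
    (φ : Coker A →ₗ[NodeRing k] Coker B) :
    ∃ U W : Matrix (Fin 3) (Fin 3) k,
      (∀ x, cokerEvalZero hB (φ x) = U.mulVec (cokerEvalZero hA x)) ∧
        ∀ v : Fin 3 → k, U * A.map (eval v) = B.map (eval v) * W := by
  choose c hc using fun j : Fin 3 =>
    Submodule.Quotient.mk_surjective _ (φ (Submodule.Quotient.mk (Pi.single j 1)))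
  let U : Matrix (Fin 3) (Fin 3) (NodeRing k) := Matrix.of fun i j => c j i
  have hU : ∀ x, φ (Submodule.Quotient.mk x) = Submodule.Quotient.mk (U.mulVec x) := by
    intro x
    have : φ ∘ₗ Submodule.mkQ _ = Submodule.mkQ _ ∘ₗ Matrix.mulVecLin U := by
      refine LinearMap.pi_ext' fun j => LinearMap.ext_ring ?_
      simp only [LinearMap.comp_apply, LinearMap.coe_single, Submodule.mkQ_apply,
        Matrix.mulVecLin_apply, Matrix.mulVec_single_one]
      exact (hc j).symm
    exact LinearMap.congr_fun this x
  have hW : ∀ j, ∃ w, (B.map (quot k)).mulVec w = U.mulVec fun i => quot k (A i j) := by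
    intro j
    have h1 : (Submodule.Quotient.mk (fun i => quot k (A i j)) : Coker A) = 0 := by
      rw [Submodule.Quotient.mk_eq_zero]
      refine ⟨Pi.single j 1, ?_⟩
      rw [Matrix.mulVecLin_apply, Matrix.mulVec_single_one]
      rfl
    have h2 := hU fun i => quot k (A i j)
    rw [h1, map_zero, eq_comm, Submodule.Quotient.mk_eq_zero] at h2
    exact h2
  choose w hw using hW
  refine ⟨U.map (evalZero k), Matrix.of fun i j => evalZero k (w j i), ?_, ?_⟩
  · intro x
    obtain ⟨x, rfl⟩ := Submodule.Quotient.mk_surjective _ x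
    ext i
    rw [hU, cokerEvalZero_mk]
    exact RingHom.map_mulVec (evalZero k) U x i
  · intro v
    ext i j
    have h1 := congrArg (fun r => (tangent v r).snd) (congrFun (hw j) i)
    have hA0 : ∀ i j, evalZero k (quot k (A i j)) = 0 := fun i j => by
      rw [evalZero_quot, eval_zero, constantCoeff_eq]
      exact (hA i j).coeff_eq_zero (by simp)
    have hB0 : ∀ i j, evalZero k (quot k (B i j)) = 0 := fun i j => by
      rw [evalZero_quot, eval_zero, constantCoeff_eq]
      exact (hB i j).coeff_eq_zero (by simp)
    simp only [Matrix.mulVec, dotProduct, map_sum, TrivSqZeroExt.snd_sum, snd_tangent_mul,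
      Matrix.map_apply, hA0, hB0, snd_tangent_quot (hA _ _), snd_tangent_quot (hB _ _), zero_mul,
      add_zero, zero_add] at h1
    simp only [Matrix.mul_apply, Matrix.map_apply, Matrix.of_apply]
    rw [← h1]
    exact Finset.sum_congr rfl fun l _ => mul_comm _ _

theorem map_eval_alpha (a b : k) (v : Fin 3 → k) :
    (alpha a b).map (eval v) = !![0, v 0 - a * v 2, v 1 - b * v 2;
      v 0, v 1 + b * v 2, (a ^ 2 + a) * v 2;
      v 2, 0, -v 0 - (a + 1) * v 2] := by
  ext i j
  fin_cases i <;> fin_cases j <;> simp [alpha]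

theorem alpha_parameters_eq {a b c d : k} {U W : Matrix (Fin 3) (Fin 3) k}
    (h : ∀ v : Fin 3 → k, U * (alpha a b).map (eval v) = (alpha c d).map (eval v) * W)
    (hU : IsUnit U) : a = c ∧ b = d := by
  have h1 := h ![1, 0, 0]
  have h2 := h ![0, 1, 0]
  have h3 := h ![0, 0, 1]
  rw [map_eval_alpha, map_eval_alpha] at h1 h2 h3
  rw [← Matrix.ext_iff] at h1 h2 h3
  simp [Fin.forall_fin_succ, Matrix.mul_apply, Fin.sum_univ_three] at h1 h2 h3
  -- The equations at the first two unit vectors eliminate W and make U commute with a nilpotent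
  -- matrix that is a single Jordan block. So U is a polynomial in that matrix, and U 2 2 is its
  -- only eigenvalue.
  have hu : U 2 2 ≠ 0 := by
    intro h0
    have : U.det = 0 := by
      rw [Matrix.det_fin_three]
      grind
    rw [Matrix.isUnit_iff_isUnit_det, this] at hU
    exact not_isUnit_zero hU
  constructor
  · apply mul_left_cancel₀ hu
    grind
  · apply mul_left_cancel₀ hu
    grind

theorem alpha_parameters_eq_of_equiv {a b c d : k}
    (e : Coker (alpha a b) ≃ₗ[NodeRing k] Coker (alpha c d)) : a = c ∧ b = d := by
  have hA := isHomogeneous_alpha a b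
  have hB := isHomogeneous_alpha c d
  obtain ⟨U, W, hU, hUW⟩ := exists_matrix_of_linearMap hA hB e.toLinearMap
  obtain ⟨U', W', hU', -⟩ := exists_matrix_of_linearMap hB hA e.symm.toLinearMap
  refine alpha_parameters_eq hUW ?_
  have h1 : U' * U = 1 := by
    apply Matrix.ext_of_mulVec_single
    intro i
    obtain ⟨x, hx⟩ := cokerEvalZero_surjective hA (Pi.single i 1)
    rw [← hx, ← Matrix.mulVec_mulVec, ← hU, ← hU', Matrix.one_mulVec]
    simp
  exact IsUnit.of_mul_eq_one_right _ h1

end Tangent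

/-! ### Points of the affine chart y₃ = 1. -/

section Points

variable {k : Type u} [Field k]

theorem pt_mem_curve_iff {a b : k} : pt a b ∈ curve k ↔ b ^ 2 = a ^ 3 + a ^ 2 := by
  obtain ⟨c, hc⟩ := Projectivization.exists_smul_eq_mk_rep k ![a, b, 1]
    fun h => one_ne_zero (congrFun h 2)
  have hc0 : (c : k) ≠ 0 := c.ne_zero
  change eval (Projectivization.mk k ![a, b, 1] _).rep (cubic k) = 0 ↔ _
  rw [← hc]
  have h1 : eval (c • ![a, b, 1]) (cubic k) = (c : k) ^ 3 * (a ^ 3 + a ^ 2 - b ^ 2) := by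
    simp [cubic, Units.smul_def]
    ring
  rw [h1, mul_eq_zero, or_iff_right (pow_ne_zero 3 hc0), sub_eq_zero, eq_comm]

theorem pt_mem_regularLocus {a b : k} (h : b ^ 2 = a ^ 3 + a ^ 2) (h0 : ¬ (a = 0 ∧ b = 0)) :
    pt a b ∈ regularLocus k \ {pt₀ k} := by
  refine ⟨⟨pt_mem_curve_iff.2 h, ?_⟩, ?_⟩
  · obtain ⟨c, hc⟩ := Projectivization.exists_smul_eq_mk_rep k ![a, b, 1]
      fun h => one_ne_zero (congrFun h 2)
    have hc0 : (c : k) ≠ 0 := c.ne_zero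
    change ∃ i, eval (Projectivization.mk k ![a, b, 1] _).rep _ ≠ 0
    rw [← hc]
    by_contra! hcon
    have e0 := hcon 0
    have e1 := hcon 1
    have e2 := hcon 2
    simp [cubic, Units.smul_def, pderiv_X] at e0 e1 e2
    -- The derivative in y₃, together with the equation of the curve, already forces a = b = 0, so
    -- the characteristic plays no role.
    have e2' : a ^ 2 - b ^ 2 = 0 := by
      apply mul_left_cancel₀ (pow_ne_zero 2 hc0)
      linear_combination e2
    have h3 : a ^ 3 = 0 := by linear_combination -e2' - h
    have ha : a = 0 := by simpa using h3
    refine h0 ⟨ha, ?_⟩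
    rw [ha] at h
    simpa using h
  · intro h1
    rw [Set.mem_singleton_iff, pt, pt₀, Projectivization.mk_eq_mk_iff'] at h1
    obtain ⟨c, hc⟩ := h1
    simpa using congrFun hc 2

end Points

/-! ### Simultaneous normal form of the pair (P, Q). -/

section NormalForm

variable {k : Type u} [Field k]

/-- The identity `Φ³ + y₃ Φ² = y₂² y₃` for the matrix `Φ = y₂ P + y₃ Q`, by coefficients. -/
structure IsCubicPair (P Q : Matrix (Fin 3) (Fin 3) k) : Prop where
  pow_three : P * P * P = 0
  two_one : P * P * Q + P * Q * P + Q * P * P + P * P = 1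
  one_two : P * Q * Q + Q * P * Q + Q * Q * P + P * Q + Q * P = 0
  zero_three : Q * Q * Q + Q * Q = 0

theorem IsCubicPair.conj {P Q P' Q' B : Matrix (Fin 3) (Fin 3) k} (h : IsCubicPair P Q)
    (hB : IsUnit B) (hP : P * B = B * P') (hQ : Q * B = B * Q') : IsCubicPair P' Q' := by
  have hP' : ∀ X, B * (P' * X) = P * (B * X) := fun X => by
    rw [← mul_assoc, ← hP, mul_assoc]
  have hQ' : ∀ X, B * (Q' * X) = Q * (B * X) := fun X => by
    rw [← mul_assoc, ← hQ, mul_assoc]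
  obtain ⟨h1, h2, h3, h4⟩ := h
  refine ⟨?_, ?_, ?_, ?_⟩ <;> apply hB.mul_left_cancel
  · have := congrArg (· * B) h1
    simpa only [mul_add, add_mul, mul_assoc, hP', hQ', ← hP, ← hQ, mul_zero, zero_mul] using this
  · have := congrArg (· * B) h2
    simpa only [mul_add, add_mul, mul_assoc, hP', hQ', ← hP, ← hQ, mul_one, one_mul] using this
  · have := congrArg (· * B) h3
    simpa only [mul_add, add_mul, mul_assoc, hP', hQ', ← hP, ← hQ, mul_zero, zero_mul] using this
  · have := congrArg (· * B) h4
    simpa only [mul_add, add_mul, mul_assoc, hP', hQ', ← hP, ← hQ, mul_zero, zero_mul] using this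

/-- The nilpotent Jordan block of size three. -/
def jordan (k : Type u) [Field k] : Matrix (Fin 3) (Fin 3) k :=
  !![0, 1, 0; 0, 0, 1; 0, 0, 0]

/-- The normal form of the second matrix of a cubic pair. -/
def normalForm (a b : k) : Matrix (Fin 3) (Fin 3) k :=
  !![0, b, -(a ^ 2 + a); 0, a, -b; 1, 0, -1 - a]

/-- If P² = 0, multiplying the second identity by P gives P = 0, which contradicts that identity. So
P is nilpotent of order exactly three, and P²v, Pv, v is a Jordan basis whenever P²v ≠ 0. -/
theorem IsCubicPair.exists_jordan {P Q : Matrix (Fin 3) (Fin 3) k} (h : IsCubicPair P Q) :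
    ∃ B : Matrix (Fin 3) (Fin 3) k, IsUnit B ∧ P * B = B * jordan k := by
  have hP2 : P * P ≠ 0 := by
    intro h0
    have h1 := h.two_one
    have h2 : P = 0 := by
      calc P = P * (P * P * Q + P * Q * P + Q * P * P + P * P) := by rw [h1, mul_one]
        _ = P * P * P * Q + P * P * Q * P + P * Q * (P * P) + P * P * P := by noncomm_ring
        _ = 0 := by simp [h0]
    rw [h2] at h1
    simp at h1
  obtain ⟨v, hv⟩ : ∃ v, (P * P).mulVec v ≠ 0 := by
    by_contra! hcon
    refine hP2 (Matrix.ext_of_mulVec_single fun i => ?_)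
    rw [hcon, Matrix.zero_mulVec]
  have hv3 : P.mulVec ((P * P).mulVec v) = 0 := by
    rw [Matrix.mulVec_mulVec, ← mul_assoc, h.pow_three, Matrix.zero_mulVec]
  have hv2 : P.mulVec (P.mulVec v) = (P * P).mulVec v := Matrix.mulVec_mulVec _ _ _
  let B : Matrix (Fin 3) (Fin 3) k := (Matrix.of ![(P * P).mulVec v, P.mulVec v, v]).transpose
  have hBx : ∀ x, B.mulVec x = x 0 • (P * P).mulVec v + x 1 • P.mulVec v + x 2 • v := by
    intro x
    ext i
    simp [B, Matrix.mulVec, dotProduct, Fin.sum_univ_three]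
    ring
  refine ⟨B, ?_, ?_⟩
  · rw [← Matrix.mulVec_injective_iff_isUnit]
    rw [← Matrix.coe_mulVecLin, injective_iff_map_eq_zero]
    intro x hx
    rw [Matrix.mulVecLin_apply, hBx] at hx
    have h2 := congrArg P.mulVec hx
    simp only [Matrix.mulVec_add, Matrix.mulVec_smul, hv3, hv2, smul_zero, zero_add,
      Matrix.mulVec_zero] at h2
    have h3 := congrArg P.mulVec h2
    simp only [Matrix.mulVec_add, Matrix.mulVec_smul, hv3, hv2, smul_zero, zero_add,
      Matrix.mulVec_zero] at h3
    have x2 : x 2 = 0 := (smul_eq_zero.1 h3).resolve_right hv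
    rw [x2, zero_smul, add_zero] at h2
    have x1 : x 1 = 0 := (smul_eq_zero.1 h2).resolve_right hv
    rw [x1, x2, zero_smul, zero_smul, add_zero, add_zero] at hx
    have x0 : x 0 = 0 := (smul_eq_zero.1 hx).resolve_right hv
    ext i
    fin_cases i
    · exact x0
    · exact x1
    · exact x2
  · refine Matrix.ext_of_mulVec_single fun i => ?_
    rw [← Matrix.mulVec_mulVec, ← Matrix.mulVec_mulVec, hBx, hBx]
    simp only [Matrix.mulVec_add, Matrix.mulVec_smul, hv3, hv2, Matrix.mulVec_single_one]
    fin_cases i <;> simp [jordan]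

theorem IsCubicPair.jordan_entries {N : Matrix (Fin 3) (Fin 3) k}
    (h : IsCubicPair (jordan k) N) :
    N 2 0 = 1 ∧ N 1 0 + N 2 1 = 0 ∧ N 0 0 + N 1 1 + N 2 2 = -1 := by
  have e00 := congrFun (congrFun h.two_one 0) 0
  have e01 := congrFun (congrFun h.two_one 0) 1
  have e02 := congrFun (congrFun h.two_one 0) 2
  simp only [Matrix.add_apply, Matrix.mul_apply, Fin.sum_univ_three, jordan, Matrix.of_apply,
    Matrix.cons_val', Matrix.cons_val_zero, Matrix.cons_val_one, Matrix.cons_val,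
    Matrix.one_apply_eq, Matrix.one_apply_ne (show (0 : Fin 3) ≠ 1 by decide),
    Matrix.one_apply_ne (show (0 : Fin 3) ≠ 2 by decide)] at e00 e01 e02
  exact ⟨by linear_combination e00, by linear_combination e01, by linear_combination e02⟩

/-- Once two entries are normalized to zero, the identities linear in N and quadratic in N determine
all entries but two; the last diagonal entry of the cubic identity is the equation of the curve. -/
theorem IsCubicPair.eq_normalForm {N : Matrix (Fin 3) (Fin 3) k}
    (h : IsCubicPair (jordan k) N) (h00 : N 0 0 = 0) (h21 : N 2 1 = 0) :
    N = normalForm (N 1 1) (N 0 1) ∧ N 0 1 ^ 2 = N 1 1 ^ 3 + N 1 1 ^ 2 := by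
  obtain ⟨h20, h10, htr⟩ := h.jordan_entries
  rw [h21, add_zero] at h10
  have h22 : N 2 2 = -1 - N 1 1 := by linear_combination htr - h00
  have e00 := congrFun (congrFun h.one_two 0) 0
  have e01 := congrFun (congrFun h.one_two 0) 1
  have e22 := congrFun (congrFun h.zero_three 2) 2
  simp only [Matrix.add_apply, Matrix.mul_apply, Fin.sum_univ_three, jordan, Matrix.of_apply,
    Matrix.cons_val', Matrix.cons_val_zero, Matrix.cons_val_one, Matrix.cons_val,
    Matrix.zero_apply, h00, h21, h20, h10, h22] at e00 e01 e22
  have h12 : N 1 2 = -N 0 1 := by linear_combination e00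
  have h02 : N 0 2 = -(N 1 1 ^ 2 + N 1 1) := by linear_combination e01
  rw [h12, h02] at e22
  refine ⟨?_, by linear_combination -e22⟩
  ext i j
  fin_cases i <;> fin_cases j
  · exact h00
  · rfl
  · exact h02
  · exact h10
  · rfl
  · exact h12
  · exact h20
  · exact h21
  · exact h22

theorem IsCubicPair.exists_normalForm_of_jordan {Q : Matrix (Fin 3) (Fin 3) k}
    (h : IsCubicPair (jordan k) Q) :
    ∃ (B : Matrix (Fin 3) (Fin 3) k) (a b : k), IsUnit B ∧ jordan k * B = B * jordan k ∧
      Q * B = B * normalForm a b ∧ b ^ 2 = a ^ 3 + a ^ 2 := by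
  obtain ⟨h20, h10, htr⟩ := h.jordan_entries
  generalize hc : Q 1 0 = c at h10
  generalize hd : Q 0 0 = d at htr
  -- B = 1 + cJ + dJ² is a polynomial in the Jordan block J, hence commutes with it; c and d are
  -- chosen so that conjugation kills the entries (2, 1) and (0, 0) of Q.
  let B : Matrix (Fin 3) (Fin 3) k := !![1, c, d; 0, 1, c; 0, 0, 1]
  let B' : Matrix (Fin 3) (Fin 3) k := !![1, -c, c ^ 2 - d; 0, 1, -c; 0, 0, 1]
  have hBB' : B * B' = 1 := by
    ext i j
    fin_cases i <;> fin_cases j <;> simp [B, B', Matrix.mul_apply, Fin.sum_univ_three]; ring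
  have hB : IsUnit B := IsUnit.of_mul_eq_one _ hBB'
  have hJ : jordan k * B = B * jordan k := by
    ext i j
    fin_cases i <;> fin_cases j <;> simp [B, jordan, Matrix.mul_apply, Fin.sum_univ_three]
  have hQ : Q * B = B * (B' * Q * B) := by
    rw [← mul_assoc, ← mul_assoc, hBB', one_mul]
  have n00 : (B' * Q * B) 0 0 = 0 := by
    simp only [B, B', Matrix.mul_apply, Fin.sum_univ_three, Matrix.of_apply, Matrix.cons_val',
      Matrix.cons_val_zero, Matrix.cons_val_one, Matrix.cons_val, h20, hc, hd]
    ring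
  have n21 : (B' * Q * B) 2 1 = 0 := by
    simp only [B, B', Matrix.mul_apply, Fin.sum_univ_three, Matrix.of_apply, Matrix.cons_val',
      Matrix.cons_val_zero, Matrix.cons_val_one, Matrix.cons_val, h20, hc, hd]
    linear_combination h10
  obtain ⟨hN, hab⟩ := (h.conj hB hJ hQ).eq_normalForm n00 n21
  exact ⟨B, _, _, hB, hJ, hQ.trans (congrArg (B * ·) hN), hab⟩

theorem IsCubicPair.exists_normalForm {P Q : Matrix (Fin 3) (Fin 3) k} (h : IsCubicPair P Q) :
    ∃ (B : Matrix (Fin 3) (Fin 3) k) (a b : k), IsUnit B ∧ P * B = B * jordan k ∧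
      Q * B = B * normalForm a b ∧ b ^ 2 = a ^ 3 + a ^ 2 := by
  obtain ⟨B, hB, hP⟩ := h.exists_jordan
  have hBdet := (Matrix.isUnit_iff_isUnit_det B).1 hB
  have hQ : Q * B = B * (B⁻¹ * Q * B) := by
    rw [← mul_assoc, ← mul_assoc, Matrix.mul_nonsing_inv _ hBdet, one_mul]
  obtain ⟨D, a, b, hD, hJD, hND, hab⟩ := (h.conj hB hP hQ).exists_normalForm_of_jordan
  refine ⟨B * D, a, b, hB.mul hD, ?_, ?_, hab⟩
  · rw [← mul_assoc, hP, mul_assoc, hJD, mul_assoc]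
  · rw [← mul_assoc, hQ, mul_assoc, hND, mul_assoc]

end NormalForm

/-! ### Projections onto the components of an internal grading. -/

section Graded

variable {M : Type v} [AddCommGroup M] {𝓜 : ℤ → AddSubgroup M}

/-- The projection of an internally graded group onto the component of degree `d`. -/
def gradeProj (h : DirectSum.IsInternal 𝓜) (d : ℤ) : M →+ M :=
  (𝓜 d).subtype.comp ((DFinsupp.evalAddMonoidHom d).comp
    (AddEquiv.ofBijective (DirectSum.coeAddMonoidHom 𝓜) h).symm.toAddMonoidHom)

theorem gradeProj_mem (h : DirectSum.IsInternal 𝓜) (d : ℤ) (m : M) : gradeProj h d m ∈ 𝓜 d :=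
  Subtype.property _

theorem gradeProj_of_mem (h : DirectSum.IsInternal 𝓜) {e : ℤ} {m : M} (hm : m ∈ 𝓜 e) (d : ℤ) :
    gradeProj h d m = if d = e then m else 0 := by
  have h1 : (AddEquiv.ofBijective (DirectSum.coeAddMonoidHom 𝓜) h).symm m =
      DirectSum.of (fun i => 𝓜 i) e ⟨m, hm⟩ := by
    rw [AddEquiv.symm_apply_eq]
    exact (DirectSum.coeAddMonoidHom_of 𝓜 e ⟨m, hm⟩).symm
  change ((((AddEquiv.ofBijective (DirectSum.coeAddMonoidHom 𝓜) h).symm m) d : 𝓜 d) : M) = _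
  rw [h1, DirectSum.coe_of_apply]
  by_cases hd : d = e
  · subst hd; simp
  · rw [if_neg (Ne.symm hd), if_neg hd]; rfl

theorem exists_sum_gradeProj (h : DirectSum.IsInternal 𝓜) (m : M) :
    ∃ s : Finset ℤ, ∑ d ∈ s, gradeProj h d m = m := by
  classical
  refine ⟨DFinsupp.support ((AddEquiv.ofBijective (DirectSum.coeAddMonoidHom 𝓜) h).symm m), ?_⟩
  refine Eq.trans ?_ ((AddEquiv.ofBijective (DirectSum.coeAddMonoidHom 𝓜) h).apply_symm_apply m)
  exact (DirectSum.coeAddMonoidHom_eq_dfinsuppSum 𝓜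
    ((AddEquiv.ofBijective (DirectSum.coeAddMonoidHom 𝓜) h).symm m)).symm

theorem eq_zero_of_gradeProj (h : DirectSum.IsInternal 𝓜) {m : M}
    (hm : ∀ d, gradeProj h d m = 0) : m = 0 := by
  obtain ⟨s, hs⟩ := exists_sum_gradeProj h m
  rw [← hs]
  exact Finset.sum_eq_zero fun d _ => hm d

theorem graded_induction (h : DirectSum.IsInternal 𝓜) {p : M → Prop} (zero : p 0)
    (add : ∀ x y, p x → p y → p (x + y)) (hom : ∀ d, ∀ x ∈ 𝓜 d, p x) (m : M) : p m := by
  obtain ⟨s, hs⟩ := exists_sum_gradeProj h m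
  rw [← hs]
  exact Finset.sum_induction _ p add zero fun d _ => hom d _ (gradeProj_mem h d m)

/-- An additive bijection that is homogeneous of degree `n` detects degrees. -/
theorem mem_iff_of_homogeneous {N : Type*} [AddCommGroup N] {𝓝 : ℤ → AddSubgroup N}
    (hM : DirectSum.IsInternal 𝓜) (hN : DirectSum.IsInternal 𝓝) (φ : N →+ M)
    (hφ : Function.Injective φ) (n : ℤ) (hd : ∀ j, ∀ x ∈ 𝓝 j, φ x ∈ 𝓜 (j + n)) (j : ℤ) (x : N) :
    x ∈ 𝓝 j ↔ φ x ∈ 𝓜 (j + n) := by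
  have hc : ∀ x i, φ (gradeProj hN i x) = gradeProj hM (i + n) (φ x) := by
    intro x i
    induction x using graded_induction hN with
    | zero => simp
    | add x y hx hy => simp [hx, hy]
    | hom e x hx =>
      rw [gradeProj_of_mem hN hx, gradeProj_of_mem hM (hd e x hx)]
      by_cases h : i = e
      · simp [h]
      · simp [h]
  refine ⟨hd j x, fun hx => ?_⟩
  have h1 := hc x j
  rw [gradeProj_of_mem hM hx, if_pos rfl] at h1
  rw [← hφ h1]
  exact gradeProj_mem hN j x

end Graded

/-! ### Graded R-modules viewed over k[y₂, y₃]. -/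

section GradedModule

variable {k : Type u} [Field k] {M : Type v} [AddCommGroup M] [Module (NodeRing k) M]
  {𝓜 : ℤ → AddSubgroup M}

theorem quot_smul_mem (h : IsGraded (k := k) 𝓜) {p : MvPolynomial (Fin 3) k} {n : ℕ}
    (hp : p.IsHomogeneous n) {e : ℤ} {m : M} (hm : m ∈ 𝓜 e) : quot k p • m ∈ 𝓜 (n + e) :=
  h.2 n e _ m (quot_mem_ringDeg hp) hm

theorem gradeProj_quot_smul (h : IsGraded (k := k) 𝓜) {p : MvPolynomial (Fin 3) k} {n : ℕ}
    (hp : p.IsHomogeneous n) (d : ℤ) (m : M) :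
    gradeProj h.1 d (quot k p • m) = quot k p • gradeProj h.1 (d - n) m := by
  induction m using graded_induction h.1 with
  | zero => simp
  | add x y hx hy => simp only [smul_add, map_add, hx, hy]
  | hom e x hx =>
    rw [gradeProj_of_mem h.1 hx, gradeProj_of_mem h.1 (quot_smul_mem h hp hx)]
    by_cases hd : d = n + e
    · rw [if_pos hd, if_pos (by omega)]
    · rw [if_neg hd, if_neg (by omega), smul_zero]

theorem gradeProj_X_smul (h : IsGraded (k := k) 𝓜) (i : Fin 3) (d : ℤ) (m : M) :
    gradeProj h.1 d (quot k (X i) • m) = quot k (X i) • gradeProj h.1 (d - 1) m := by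
  have := gradeProj_quot_smul h (isHomogeneous_X k i) d m
  exact_mod_cast this

variable [Module (MvPolynomial (Fin 2) k) M] [IsScalarTower (MvPolynomial (Fin 2) k) (NodeRing k) M]

theorem smul_eq_quot_smul (a : MvPolynomial (Fin 2) k) (m : M) :
    a • m = quot k (rename Fin.succ a) • m := by
  rw [← algebraMap_eq, algebraMap_smul]

theorem X_zero_smul (m : M) : (X 0 : MvPolynomial (Fin 2) k) • m = quot k (X 1) • m := by
  rw [smul_eq_quot_smul, rename_X]
  rfl

theorem X_one_smul (m : M) : (X 1 : MvPolynomial (Fin 2) k) • m = quot k (X 2) • m := by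
  rw [smul_eq_quot_smul, rename_X]
  rfl

theorem intComponent_smul_mem (h : IsGraded (k := k) 𝓜) (a : MvPolynomial (Fin 2) k) (n : ℤ)
    {e : ℤ} {m : M} (hm : m ∈ 𝓜 e) : intComponent n a • m ∈ 𝓜 (n + e) := by
  rcases lt_or_ge n 0 with hn | hn
  · rw [intComponent_of_neg hn, zero_smul]
    exact zero_mem _
  · lift n to ℕ using hn
    rw [intComponent_natCast, smul_eq_quot_smul]
    exact quot_smul_mem h (homogeneousComponent_isHomogeneous n a).rename_isHomogeneous hm

theorem gradeProj_smul (h : IsGraded (k := k) 𝓜) (a : MvPolynomial (Fin 2) k) {e : ℤ} {m : M}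
    (hm : m ∈ 𝓜 e) (d : ℤ) : gradeProj h.1 d (a • m) = intComponent (d - e) a • m := by
  conv_lhs => rw [← sum_intComponent a, Finset.sum_smul, map_sum]
  conv_rhs => rw [← sum_intComponent a, map_sum, Finset.sum_smul]
  refine Finset.sum_congr rfl fun i _ => ?_
  rw [gradeProj_of_mem h.1 (intComponent_smul_mem h a i hm), intComponent_intComponent]
  by_cases hd : d = i + e
  · rw [if_pos hd, if_pos (by omega)]
  · rw [if_neg hd, if_neg (by omega), zero_smul]

/-- The homogeneous elements of a module generated by homogeneous elements. -/
theorem exists_sum_of_mem (h : IsGraded (k := k) 𝓜) {n : ℕ} {m : Fin n → M} {e : Fin n → ℤ}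
    (hm : ∀ i, m i ∈ 𝓜 (e i))
    (hs : Submodule.span (MvPolynomial (Fin 2) k) (Set.range m) = ⊤) {d : ℤ} {x : M}
    (hx : x ∈ 𝓜 d) :
    ∃ a : Fin n → MvPolynomial (Fin 2) k, x = ∑ i, intComponent (d - e i) (a i) • m i := by
  obtain ⟨a, ha⟩ := (Submodule.mem_span_range_iff_exists_fun _).1 (hs ▸ Submodule.mem_top (x := x))
  refine ⟨a, ?_⟩
  have h1 := gradeProj_of_mem h.1 hx d
  rw [if_pos rfl, ← ha, map_sum] at h1
  rw [← ha, ← h1]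
  exact Finset.sum_congr rfl fun i _ => gradeProj_smul h (a i) (hm i) d

theorem exists_homogeneous_generators [Module.Finite (NodeRing k) M] (h : IsGraded (k := k) 𝓜) :
    ∃ (n : ℕ) (m : Fin n → M) (e : Fin n → ℤ), (∀ i, m i ∈ 𝓜 (e i)) ∧
      Submodule.span (MvPolynomial (Fin 2) k) (Set.range m) = ⊤ := by
  classical
  have : Module.Finite (MvPolynomial (Fin 2) k) M := Module.Finite.trans (NodeRing k) M
  obtain ⟨t, ht⟩ := Module.Finite.fg_top (R := MvPolynomial (Fin 2) k) (M := M)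
  choose s hs using exists_sum_gradeProj h.1
  -- Each component is stored together with its degree, so that a degree can be read off for every
  -- generator.
  let T : Finset (ℤ × M) := t.biUnion fun x => (s x).image fun d => (d, gradeProj h.1 d x)
  refine ⟨T.card, fun i => (T.equivFin.symm i).1.2, fun i => (T.equivFin.symm i).1.1, ?_, ?_⟩
  · intro i
    have hT : ∀ y ∈ T, y.2 ∈ 𝓜 y.1 := by
      intro y hy
      simp only [T, Finset.mem_biUnion, Finset.mem_image] at hy
      obtain ⟨x, -, d, -, rfl⟩ := hy
      exact gradeProj_mem h.1 d x
    exact hT _ (T.equivFin.symm i).2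
  · rw [eq_top_iff, ← ht, Submodule.span_le]
    intro x hx
    rw [SetLike.mem_coe, ← hs x]
    refine sum_mem fun d hd => Submodule.subset_span ?_
    have hT : (d, gradeProj h.1 d x) ∈ T := by
      simp only [T, Finset.mem_biUnion, Finset.mem_image]
      exact ⟨x, hx, d, hd, rfl⟩
    exact ⟨T.equivFin ⟨_, hT⟩, by simp⟩

/-- The starting point for the inductions on the degree below. -/
theorem exists_degree_bound [Module.Finite (NodeRing k) M] (h : IsGraded (k := k) 𝓜) :
    ∃ l : ℤ, ∀ d < l, ∀ x ∈ 𝓜 d, x = 0 := by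
  obtain ⟨n, m, e, hm, hs⟩ := exists_homogeneous_generators h
  obtain ⟨l, hl⟩ := (Set.finite_range e).bddBelow
  refine ⟨l, fun d hd x hx => ?_⟩
  obtain ⟨a, ha⟩ := exists_sum_of_mem h hm hs hx
  rw [ha]
  refine Finset.sum_eq_zero fun i _ => ?_
  have : l ≤ e i := hl ⟨i, rfl⟩
  rw [intComponent_of_neg (by omega), zero_smul]

end GradedModule

/-! ### Depth two implies that y₃, y₂ is a regular sequence. -/

section Depth

variable {k : Type u} [Field k] {M : Type v} [AddCommGroup M] [Module (NodeRing k) M]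
  {𝓜 : ℤ → AddSubgroup M}

theorem exists_eq_sum_of_mem_irrelevant {r : NodeRing k} (hr : r ∈ irrelevant k) :
    ∃ a : Fin 3 → NodeRing k, r = ∑ i, a i * quot k (X i) := by
  rw [irrelevant, Ideal.mem_span_range_iff_exists_fun] at hr
  obtain ⟨a, ha⟩ := hr
  exact ⟨a, ha.symm⟩

/-- The vanishing of the first Koszul cohomology of a module of depth at least two. -/
theorem exists_eq_smul_of_cocycle {r s : NodeRing k} (hr : r ∈ irrelevant k)
    (hs : s ∈ irrelevant k) (hreg : RingTheory.Sequence.IsWeaklyRegular M [r, s])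
    (x : Fin 3 → M) (hx : ∀ i j, quot k (X i) • x j = quot k (X j) • x i) :
    ∃ w, ∀ i, x i = quot k (X i) • w := by
  obtain ⟨h1, h2⟩ := (isWeaklyRegular_pair_iff r s).1 hreg
  obtain ⟨a, rfl⟩ := exists_eq_sum_of_mem_irrelevant hr
  obtain ⟨b, rfl⟩ := exists_eq_sum_of_mem_irrelevant hs
  -- The cocycle condition turns y_j Σ c_i x_i into (Σ c_i y_i) x_j. With r = Σ a_i y_i and s = Σ
  -- b_i y_i this yields s Σ a_i x_i = r Σ b_i x_i, so regularity of s modulo r writes Σ a_i x_i as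
  -- r w.
  have hsum : ∀ (c : Fin 3 → NodeRing k) (j : Fin 3),
      quot k (X j) • ∑ i, c i • x i = (∑ i, c i * quot k (X i)) • x j := by
    intro c j
    rw [Finset.smul_sum, Finset.sum_smul]
    refine Finset.sum_congr rfl fun i _ => ?_
    rw [smul_comm, hx j i, mul_smul]
  obtain ⟨w, hw⟩ := h2 (∑ i, a i • x i) (∑ i, b i • x i) (by
    rw [Finset.sum_smul, Finset.smul_sum]
    refine Finset.sum_congr rfl fun j _ => ?_
    rw [mul_smul, hsum, smul_comm])
  refine ⟨w, fun j => ?_⟩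
  rw [← sub_eq_zero]
  apply h1
  rw [smul_sub, ← hsum a j, hw, smul_comm, sub_self]

theorem cubic_relation (m : M) :
    quot k (X 0) • quot k (X 0) • quot k (X 0) • m =
      quot k (X 2) • (quot k (X 1 ^ 2 - X 0 ^ 2) • m) := by
  have h : quot k (cubic k) = 0 := (quot_eq_zero_iff k).2 dvd_rfl
  simp only [smul_smul]
  congr 1
  rw [← map_mul, ← map_mul, ← map_mul, ← sub_eq_zero, ← map_sub, ← h]
  congr 1
  simp only [cubic]
  ring

/-- The given regular sequence r, s need not be homogeneous, so it is used only through the Koszul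
statement. If y₁ and y₃ kill n, then (0, n, 0) is a cocycle, so n = y₂ w with w again killed by y₁
and y₃; descent in the degree gives n = 0. If only y₃ m = 0 is known, then y₁³ m = 0 by the cubic,
and the first case applies in turn to y₁² m, y₁ m and m. -/
theorem X_two_smul_injective [Module.Finite (NodeRing k) M] (h : IsGraded (k := k) 𝓜)
    {r s : NodeRing k} (hr : r ∈ irrelevant k)
    (hs : s ∈ irrelevant k) (hreg : RingTheory.Sequence.IsWeaklyRegular M [r, s])
    (m : M) (hm : quot k (X 2) • m = 0) : m = 0 := by
  let _ : Module (MvPolynomial (Fin 2) k) M := Module.compHom M (algebraMap _ (NodeRing k))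
  have : IsScalarTower (MvPolynomial (Fin 2) k) (NodeRing k) M :=
    IsScalarTower.of_algebraMap_smul fun _ _ => rfl
  obtain ⟨l, hl⟩ := exists_degree_bound h
  have key : ∀ (j : ℕ) (d : ℤ), d < l + j → ∀ n ∈ 𝓜 d, quot k (X 0) • n = 0 →
      quot k (X 2) • n = 0 → n = 0 := by
    intro j
    induction j with
    | zero => exact fun d hd n hn _ _ => hl d (by simpa using hd) n hn
    | succ j ih =>
      intro d hd n hn h0 h2
      obtain ⟨w, hw⟩ := exists_eq_smul_of_cocycle hr hs hreg ![0, n, 0] (by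
        intro i j
        fin_cases i <;> fin_cases j <;> simp [h0, h2])
      have hw0 : quot k (X 0) • w = 0 := (hw 0).symm
      have hw1 : n = quot k (X 1) • w := hw 1
      have hw2 : quot k (X 2) • w = 0 := (hw 2).symm
      have h3 : gradeProj h.1 (d - 1) w = 0 := by
        refine ih (d - 1) (by push_cast at hd; omega) _ (gradeProj_mem _ _ _) ?_ ?_
        · rw [← gradeProj_X_smul h, hw0, map_zero]
        · rw [← gradeProj_X_smul h, hw2, map_zero]
      have h4 := gradeProj_of_mem h.1 hn d
      rw [if_pos rfl] at h4
      rw [← h4, hw1, gradeProj_X_smul h, h3, smul_zero]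
  have key2 : ∀ n : M, quot k (X 0) • n = 0 → quot k (X 2) • n = 0 → n = 0 := by
    intro n h0 h2
    refine eq_zero_of_gradeProj h.1 fun d => ?_
    -- Any natural number larger than d - l would do; for d < l the truncation to 0 is harmless.
    refine key (d - l + 1).toNat d (by omega) _ (gradeProj_mem h.1 d n) ?_ ?_
    · have := gradeProj_X_smul h 0 (d + 1) n
      rwa [h0, map_zero, add_sub_cancel_right, eq_comm] at this
    · have := gradeProj_X_smul h 2 (d + 1) n
      rwa [h2, map_zero, add_sub_cancel_right, eq_comm] at this
  have hz : ∀ c : NodeRing k, quot k (X 2) • c • m = 0 := fun c => by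
    rw [smul_comm, hm, smul_zero]
  refine key2 m (key2 _ (key2 _ ?_ ?_) (hz _)) hm
  · rw [cubic_relation, hz]
  · rw [smul_smul (quot k (X 0)), hz]

/-- If y₁ m = y₃ w₀ and y₂ m = y₃ w₁, then (w₀, w₁, m) is a cocycle because y₃ is injective, and its
last entry gives m ∈ y₃ M. As y₁³ m ∈ y₃ M by the cubic, this applies in turn to y₁² m, y₁ m and m.
-/
theorem exists_eq_X_two_smul [Module.Finite (NodeRing k) M] (h : IsGraded (k := k) 𝓜)
    {r s : NodeRing k} (hr : r ∈ irrelevant k)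
    (hs : s ∈ irrelevant k) (hreg : RingTheory.Sequence.IsWeaklyRegular M [r, s])
    (m m' : M) (hm : quot k (X 1) • m = quot k (X 2) • m') : ∃ w, m = quot k (X 2) • w := by
  have hinj := X_two_smul_injective h hr hs hreg
  have key : ∀ m : M, (∃ w, quot k (X 0) • m = quot k (X 2) • w) →
      (∃ w, quot k (X 1) • m = quot k (X 2) • w) → ∃ w, m = quot k (X 2) • w := by
    rintro m ⟨w₀, h0⟩ ⟨w₁, h1⟩
    have h01 : quot k (X 0) • w₁ = quot k (X 1) • w₀ := by
      rw [← sub_eq_zero]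
      apply hinj
      rw [smul_sub, smul_comm _ _ w₁, smul_comm _ _ w₀, ← h0, ← h1, smul_comm, sub_self]
    obtain ⟨w, hw⟩ := exists_eq_smul_of_cocycle hr hs hreg ![w₀, w₁, m] (by
      intro i j
      fin_cases i <;> fin_cases j <;> simp [h0, h1, h01])
    exact ⟨w, hw 2⟩
  have hz : ∀ c : NodeRing k, ∃ w, quot k (X 1) • c • m = quot k (X 2) • w := fun c =>
    ⟨c • m', by rw [smul_comm, hm, smul_comm]⟩
  refine key m (key _ (key _ ⟨_, cubic_relation m⟩ ?_) (hz _)) ⟨m', hm⟩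
  rw [smul_smul (quot k (X 0))]
  exact hz _

end Depth

/-! ### Intersections of powers in k[y₂, y₃]. -/

section PolynomialRing

variable {k : Type u} [Field k]

theorem eq_zero_of_forall_pow_dvd {α : Type*} [CommRing α] [IsDomain α] [WfDvdMonoid α] {p a : α}
    (hp : Prime p) (h : ∀ n : ℕ, p ^ n ∣ a) : a = 0 := by
  by_contra ha
  obtain ⟨n, hn⟩ := FiniteMultiplicity.of_prime_left hp ha
  exact hn (h _)

theorem exists_eq_C_add (a : MvPolynomial (Fin 2) k) :
    ∃ b c, a = C (constantCoeff a) + X 0 * b + X 1 * c := by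
  induction a using MvPolynomial.induction_on with
  | C r => exact ⟨0, 0, by simp⟩
  | add p q hp hq =>
    obtain ⟨b, c, h⟩ := hp
    obtain ⟨b', c', h'⟩ := hq
    refine ⟨b + b', c + c', ?_⟩
    rw [map_add, C_add]
    linear_combination h + h'
  | mul_X p i _ =>
    fin_cases i
    · exact ⟨p, 0, by simp [mul_comm]⟩
    · exact ⟨0, p, by simp [mul_comm]⟩

theorem X_one_dvd_of_forall {a : MvPolynomial (Fin 2) k}
    (h : ∀ n : ℕ, ∃ b c, a = X 1 * c + X 0 ^ n * b) : X 1 ∣ a := by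
  let φ : MvPolynomial (Fin 2) k →ₐ[k] MvPolynomial (Fin 2) k := aeval ![X 0, 0]
  have hφ : ∀ p, X 1 ∣ p - φ p := by
    intro p
    induction p using MvPolynomial.induction_on with
    | C r => simp [φ]
    | add p q hp hq =>
      rw [map_add, add_sub_add_comm]
      exact dvd_add hp hq
    | mul_X p i hp =>
      have hi : (X 1 : MvPolynomial (Fin 2) k) ∣ X i - φ (X i) := by
        fin_cases i <;> simp [φ]
      have : p * X i - φ (p * X i) = (p - φ p) * X i + φ p * (X i - φ (X i)) := by
        rw [map_mul]; ring
      rw [this]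
      exact dvd_add (hp.mul_right _) (hi.mul_left _)
  have h0 : φ a = 0 := by
    refine eq_zero_of_forall_pow_dvd (p := X 0) X_prime fun n => ?_
    obtain ⟨b, c, hbc⟩ := h n
    refine ⟨φ b, ?_⟩
    rw [hbc]
    simp [φ]
  have := hφ a
  rwa [h0, sub_zero] at this

end PolynomialRing

/-! ### Lifting independence along a regular sequence. -/

section Independence

variable {k : Type u} [Field k] {M : Type v} [AddCommGroup M] [Module (MvPolynomial (Fin 2) k) M]

/-- Elements that are independent modulo a regular sequence of variables are independent. -/
theorem linearIndependent_of_regular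
    (h1 : ∀ m : M, (X 1 : MvPolynomial (Fin 2) k) • m = 0 → m = 0)
    (h0 : ∀ m m' : M, (X 0 : MvPolynomial (Fin 2) k) • m = (X 1 : MvPolynomial (Fin 2) k) • m' →
      ∃ w, m = (X 1 : MvPolynomial (Fin 2) k) • w)
    {n : ℕ} {m : Fin n → M}
    (hm : ∀ (a : Fin n → MvPolynomial (Fin 2) k) (u v : M),
      ∑ i, a i • m i = (X 0 : MvPolynomial (Fin 2) k) • u + (X 1 : MvPolynomial (Fin 2) k) • v →
        ∀ i, constantCoeff (a i) = 0) :
    LinearIndependent (MvPolynomial (Fin 2) k) m := by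
  have h0' : ∀ (N : ℕ) (m m' : M),
      (X 0 : MvPolynomial (Fin 2) k) ^ N • m = (X 1 : MvPolynomial (Fin 2) k) • m' →
      ∃ w, m = (X 1 : MvPolynomial (Fin 2) k) • w := by
    intro N
    induction N with
    | zero => exact fun m m' h => ⟨m', by simpa using h⟩
    | succ N ih =>
      intro m m' h
      rw [pow_succ', mul_smul] at h
      obtain ⟨w, hw⟩ := h0 _ _ h
      exact ih m w hw
  choose B D hBD using exists_eq_C_add (k := k)
  have hdvd : ∀ (a : Fin n → MvPolynomial (Fin 2) k) (v : M),
      ∑ i, a i • m i = (X 1 : MvPolynomial (Fin 2) k) • v → ∀ i, X 1 ∣ a i := by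
    intro a v hv
    -- A relation with value in y₃ M has its coefficients in (y₃, y₂^N) for every N: cancel y₂^N
    -- modulo y₃, then use that the constant terms of the new coefficients vanish.
    have key : ∀ N : ℕ, ∃ b c : Fin n → MvPolynomial (Fin 2) k,
        ∀ i, a i = X 1 * c i + X 0 ^ N * b i := by
      intro N
      induction N with
      | zero => exact ⟨a, 0, fun i => by simp⟩
      | succ N ih =>
        obtain ⟨b, c, hbc⟩ := ih
        have h2 : (X 0 : MvPolynomial (Fin 2) k) ^ N • ∑ i, b i • m i =
            (X 1 : MvPolynomial (Fin 2) k) • (v - ∑ i, c i • m i) := by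
          rw [smul_sub, ← hv, Finset.smul_sum, Finset.smul_sum, ← Finset.sum_sub_distrib]
          refine Finset.sum_congr rfl fun i _ => ?_
          rw [smul_smul, smul_smul, ← sub_smul, hbc i, add_sub_cancel_left]
        obtain ⟨w, hw⟩ := h0' N _ _ h2
        have h3 := hm b 0 w (by rw [hw, smul_zero, zero_add])
        refine ⟨fun i => B (b i), fun i => c i + X 0 ^ N * D (b i), fun i => ?_⟩
        have h4 := hBD (b i)
        rw [h3 i, C_0, zero_add] at h4
        rw [hbc i]
        linear_combination X 0 ^ N * h4
    intro i
    refine X_one_dvd_of_forall fun N => ?_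
    obtain ⟨b, c, hbc⟩ := key N
    exact ⟨b i, c i, hbc i⟩
  rw [Fintype.linearIndependent_iff]
  intro a ha i
  refine eq_zero_of_forall_pow_dvd (p := X 1) X_prime fun N => ?_
  -- For a true relation the coefficients are divisible by y₃, which can be cancelled in M;
  -- repeating this makes them divisible by every power of y₃.
  have key : ∀ N : ℕ, ∃ b : Fin n → MvPolynomial (Fin 2) k,
      (∀ i, a i = X 1 ^ N * b i) ∧ ∑ i, b i • m i = 0 := by
    intro N
    induction N with
    | zero => exact ⟨a, fun i => by simp, ha⟩
    | succ N ih =>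
      obtain ⟨b, hb, hb0⟩ := ih
      choose c hc using hdvd b 0 (by rw [hb0, smul_zero])
      refine ⟨c, fun i => by rw [hb i, hc i, pow_succ, mul_assoc], h1 _ ?_⟩
      rw [Finset.smul_sum, ← hb0]
      refine Finset.sum_congr rfl fun i _ => ?_
      rw [smul_smul, ← hc i]
  obtain ⟨b, hb, -⟩ := key N
  exact ⟨b i, hb i⟩

end Independence

/-! ### Graded Nakayama and homogeneous bases over k[y₂, y₃]. -/

section Basis

variable {k : Type u} [Field k] {M : Type v} [AddCommGroup M] [Module (NodeRing k) M]
  {𝓜 : ℤ → AddSubgroup M} [Module (MvPolynomial (Fin 2) k) M]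
  [IsScalarTower (MvPolynomial (Fin 2) k) (NodeRing k) M]

theorem gradeProj_mem_span (h : IsGraded (k := k) 𝓜) {n : ℕ} {m : Fin n → M} {e : Fin n → ℤ}
    (hm : ∀ i, m i ∈ 𝓜 (e i)) {x : M}
    (hx : x ∈ Submodule.span (MvPolynomial (Fin 2) k) (Set.range m)) (d : ℤ) :
    gradeProj h.1 d x ∈ Submodule.span (MvPolynomial (Fin 2) k) (Set.range m) := by
  obtain ⟨a, rfl⟩ := (Submodule.mem_span_range_iff_exists_fun _).1 hx
  rw [map_sum]
  refine sum_mem fun i _ => ?_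
  rw [gradeProj_smul h (a i) (hm i)]
  exact Submodule.smul_mem _ _ (Submodule.subset_span ⟨i, rfl⟩)

/-- The graded Nakayama lemma over `k[y₂, y₃]`. -/
theorem span_eq_top_of_forall [Module.Finite (NodeRing k) M] (h : IsGraded (k := k) 𝓜) {n : ℕ}
    {m : Fin n → M} {e : Fin n → ℤ} (hm : ∀ i, m i ∈ 𝓜 (e i))
    (hx : ∀ x, ∃ z ∈ Submodule.span (MvPolynomial (Fin 2) k) (Set.range m), ∃ u v : M,
      x = z + (X 0 : MvPolynomial (Fin 2) k) • u + (X 1 : MvPolynomial (Fin 2) k) • v) :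
    Submodule.span (MvPolynomial (Fin 2) k) (Set.range m) = ⊤ := by
  obtain ⟨l, hl⟩ := exists_degree_bound h
  have key : ∀ (j : ℕ) (d : ℤ), d < l + j → ∀ x ∈ 𝓜 d,
      x ∈ Submodule.span (MvPolynomial (Fin 2) k) (Set.range m) := by
    intro j
    induction j with
    | zero =>
      intro d hd x hx
      rw [hl d (by simpa using hd) x hx]
      exact zero_mem _
    | succ j ih =>
      intro d hd x hxd
      obtain ⟨z, hz, u, v, hzuv⟩ := hx x
      have h1 := gradeProj_of_mem h.1 hxd d
      rw [if_pos rfl, hzuv, X_zero_smul, X_one_smul, map_add, map_add, gradeProj_X_smul h,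
        gradeProj_X_smul h, ← X_zero_smul, ← X_one_smul, ← X_zero_smul, ← X_one_smul, ← hzuv] at h1
      rw [← h1]
      have hj : d - 1 < l + j := by push_cast at hd; omega
      exact add_mem (add_mem (gradeProj_mem_span h hm hz d)
        (Submodule.smul_mem _ _ (ih _ hj _ (gradeProj_mem h.1 _ _))))
        (Submodule.smul_mem _ _ (ih _ hj _ (gradeProj_mem h.1 _ _)))
  rw [eq_top_iff]
  intro x _
  induction x using graded_induction h.1 with
  | zero => exact zero_mem _
  | add x y hx hy => exact add_mem (hx trivial) (hy trivial)
  | hom d x hx => exact key (d - l + 1).toNat d (by omega) x hx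

/-- A module of depth two has a homogeneous basis over `k[y₂, y₃]`. -/
theorem exists_homogeneous_basis [Module.Finite (NodeRing k) M] (h : IsGraded (k := k) 𝓜)
    (h1 : ∀ m : M, (X 1 : MvPolynomial (Fin 2) k) • m = 0 → m = 0)
    (h0 : ∀ m m' : M, (X 0 : MvPolynomial (Fin 2) k) • m = (X 1 : MvPolynomial (Fin 2) k) • m' →
      ∃ w, m = (X 1 : MvPolynomial (Fin 2) k) • w) :
    ∃ (n : ℕ) (m : Fin n → M) (e : Fin n → ℤ), (∀ i, m i ∈ 𝓜 (e i)) ∧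
      Submodule.span (MvPolynomial (Fin 2) k) (Set.range m) = ⊤ ∧
      LinearIndependent (MvPolynomial (Fin 2) k) m := by
  classical
  have hex := exists_homogeneous_generators (k := k) h
  obtain ⟨m, e, hm, hs⟩ := Nat.find_spec hex
  refine ⟨Nat.find hex, m, e, hm, hs, linearIndependent_of_regular h1 h0 ?_⟩
  have hmin : ∀ n' < Nat.find hex, _ := fun n' hn' => Nat.find_min hex hn'
  generalize Nat.find hex = n at m e hmin
  intro a u v hauv i₀
  by_contra hc
  obtain _ | n := n
  · exact i₀.elim0
  -- A nonzero constant term at i₀ puts m i₀ into the span of the other generators plus (y₂, y₃)M.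
  -- By Nakayama the others then generate M, contradicting minimality.
  refine hmin n (Nat.lt_succ_self n) ⟨fun i => m (i₀.succAbove i), fun i => e (i₀.succAbove i),
    fun i => hm _, span_eq_top_of_forall h (fun i => hm _) ?_⟩
  set N := Submodule.span (MvPolynomial (Fin 2) k) (Set.range fun i => m (i₀.succAbove i))
  obtain ⟨b, c, hbc⟩ := exists_eq_C_add (a i₀)
  set γ := constantCoeff (a i₀)
  have hγ : (C γ⁻¹ * C γ : MvPolynomial (Fin 2) k) = 1 := by
    rw [← C_mul, inv_mul_cancel₀ hc, C_1]
  have hsum : ∀ d : Fin n → MvPolynomial (Fin 2) k, ∑ i, d i • m (i₀.succAbove i) ∈ N :=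
    fun d => sum_mem fun i _ => Submodule.smul_mem _ _ (Submodule.subset_span ⟨i, rfl⟩)
  have hm₀ : ∃ z ∈ N, ∃ u v : M, m i₀ = z + (X 0 : MvPolynomial (Fin 2) k) • u +
      (X 1 : MvPolynomial (Fin 2) k) • v := by
    refine ⟨C γ⁻¹ • -∑ i, a (i₀.succAbove i) • m (i₀.succAbove i),
      Submodule.smul_mem _ _ (neg_mem (hsum _)), (C γ⁻¹ : MvPolynomial (Fin 2) k) • (u - b • m i₀),
      (C γ⁻¹ : MvPolynomial (Fin 2) k) • (v - c • m i₀), ?_⟩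
    rw [Fin.sum_univ_succAbove _ i₀, hbc] at hauv
    have h2 : (C γ : MvPolynomial (Fin 2) k) • m i₀ =
        -∑ i, a (i₀.succAbove i) • m (i₀.succAbove i) +
          (X 0 : MvPolynomial (Fin 2) k) • (u - b • m i₀) +
          (X 1 : MvPolynomial (Fin 2) k) • (v - c • m i₀) := by
      linear_combination (norm := module) hauv
    rw [smul_comm (X 0 : MvPolynomial (Fin 2) k), smul_comm (X 1 : MvPolynomial (Fin 2) k),
      ← smul_add, ← smul_add, ← h2, smul_smul, hγ, one_smul]
  obtain ⟨z, hz, u', v', hz'⟩ := hm₀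
  intro x
  obtain ⟨d, rfl⟩ := (Submodule.mem_span_range_iff_exists_fun _).1
    (hs ▸ Submodule.mem_top (x := x))
  refine ⟨d i₀ • z + ∑ i, d (i₀.succAbove i) • m (i₀.succAbove i),
    add_mem (Submodule.smul_mem _ _ hz) (hsum _), d i₀ • u', d i₀ • v', ?_⟩
  rw [Fin.sum_univ_succAbove _ i₀, hz']
  module

end Basis

/-! ### Comparing ranks over R and over k[y₂, y₃]. -/

section Rank

variable {k : Type u} [Field k] {M : Type v} [AddCommGroup M] [Module (NodeRing k) M]
  [Module (MvPolynomial (Fin 2) k) M] [IsScalarTower (MvPolynomial (Fin 2) k) (NodeRing k) M]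

theorem smul_eq_zero_of_linearIndependent {n : ℕ} {m : Fin n → M}
    (hs : Submodule.span (MvPolynomial (Fin 2) k) (Set.range m) = ⊤)
    (hi : LinearIndependent (MvPolynomial (Fin 2) k) m) {r : NodeRing k} (hr : r ≠ 0) {x : M}
    (hx : r • x = 0) : x = 0 := by
  obtain ⟨s, a, ha, hsr⟩ := exists_mul_eq_algebraMap k hr
  have h1 : a • x = 0 := by
    rw [← algebraMap_smul (NodeRing k) a x, ← hsr, mul_smul, hx, smul_zero]
  obtain ⟨d, rfl⟩ := (Submodule.mem_span_range_iff_exists_fun _).1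
    (hs ▸ Submodule.mem_top (x := x))
  rw [Finset.smul_sum] at h1
  simp only [smul_smul] at h1
  have h2 := Fintype.linearIndependent_iff.1 hi _ h1
  refine Finset.sum_eq_zero fun i _ => ?_
  rw [(mul_eq_zero.1 (h2 i)).resolve_left ha, zero_smul]

/-- A nonzero x embeds R into M with R-torsion quotient. Every nonzero element of R has a nonzero
multiple in k[y₂, y₃], so the quotient is torsion over that ring too, and M has the same rank over
it as R. -/
theorem card_eq_three_of_rank {n : ℕ} {m : Fin n → M}
    (hs : Submodule.span (MvPolynomial (Fin 2) k) (Set.range m) = ⊤)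
    (hi : LinearIndependent (MvPolynomial (Fin 2) k) m)
    (hrank : Module.rank (NodeRing k) M = 1) : n = 3 := by
  have htf := fun (r : NodeRing k) (hr : r ≠ 0) (x : M) (hx : r • x = 0) =>
    smul_eq_zero_of_linearIndependent hs hi hr hx
  obtain ⟨x, hx⟩ : ∃ x : M, x ≠ 0 := by
    by_contra! hcon
    have : Module.rank (NodeRing k) M = 0 :=
      rank_eq_zero_iff.2 fun x => ⟨1, one_ne_zero, by rw [hcon x, smul_zero]⟩
    rw [this] at hrank
    exact zero_ne_one hrank
  let φ : NodeRing k →ₗ[NodeRing k] M := LinearMap.toSpanSingleton _ _ x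
  have hφ : Function.Injective φ := by
    rw [injective_iff_map_eq_zero]
    intro r hr
    by_contra hr0
    exact hx (htf r hr0 x hr)
  have hq : Module.rank (NodeRing k) (M ⧸ LinearMap.range φ) = 0 := by
    have h1 := rank_quotient_add_rank_of_isDomain (LinearMap.range φ)
    have h2 := (LinearEquiv.ofInjective φ hφ).lift_rank_eq.symm
    rw [Module.rank_self, Cardinal.lift_one, Cardinal.lift_eq_one] at h2
    rw [h2, hrank] at h1
    exact Cardinal.eq_of_add_eq_add_right (h1.trans (zero_add 1).symm) Cardinal.one_lt_aleph0
  let φA : NodeRing k →ₗ[MvPolynomial (Fin 2) k] M := φ.restrictScalars _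
  have hqA : Module.rank (MvPolynomial (Fin 2) k) (M ⧸ LinearMap.range φA) = 0 := by
    rw [rank_eq_zero_iff] at hq ⊢
    intro y
    obtain ⟨y, rfl⟩ := Submodule.Quotient.mk_surjective _ y
    obtain ⟨r, hr, hry⟩ := hq (Submodule.Quotient.mk y)
    obtain ⟨s, a, ha, hsr⟩ := exists_mul_eq_algebraMap k hr
    refine ⟨a, ha, ?_⟩
    rw [← Submodule.Quotient.mk_smul, Submodule.Quotient.mk_eq_zero] at hry ⊢
    obtain ⟨t, ht⟩ := hry
    refine ⟨s * t, ?_⟩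
    change φ (s • t) = a • y
    rw [map_smul, ht, ← algebraMap_smul (NodeRing k) a y, ← hsr, mul_smul]
  have h1 := rank_quotient_add_rank_of_isDomain (LinearMap.range φA)
  have h2 := (LinearEquiv.ofInjective φA hφ).lift_rank_eq.symm
  rw [rank_nodeRing, Cardinal.lift_ofNat] at h2
  replace h2 := Cardinal.lift_eq_nat_iff (n := 3).1 (h2.trans Nat.cast_ofNat.symm)
  have h3 := rank_eq_card_basis (Module.Basis.mk hi hs.ge)
  rw [hqA, h2, h3, zero_add, Fintype.card_fin] at h1
  exact_mod_cast h1.symm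

end Rank

/-! ### The basis elements have equal degrees. -/

section Degrees

variable {k : Type u} [Field k] {M : Type v} [AddCommGroup M] [Module (NodeRing k) M]
  {𝓜 : ℤ → AddSubgroup M} [Module (MvPolynomial (Fin 2) k) M]
  [IsScalarTower (MvPolynomial (Fin 2) k) (NodeRing k) M]

theorem smul_mem_of_nodeRing (N : Submodule (NodeRing k) M) (a : MvPolynomial (Fin 2) k) {x : M}
    (hx : x ∈ N) : a • x ∈ N := by
  rw [smul_eq_quot_smul]
  exact N.smul_mem _ hx

/-- A relation with a unit coefficient makes a generator superfluous. -/
theorem not_isMinimallyGenerated {m : Fin 3 → M}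
    (hs : Submodule.span (MvPolynomial (Fin 2) k) (Set.range m) = ⊤) {i : Fin 3}
    (hi : m i ∈ Submodule.span (NodeRing k) (Set.range fun l => m (i.succAbove l))) :
    ¬ IsMinimallyGenerated k M 3 := by
  intro hmin
  set T := Submodule.span (NodeRing k) (Set.range fun l => m (i.succAbove l)) with hT
  have hall : ∀ l, m l ∈ T := by
    intro l
    by_cases hl : l = i
    · rw [hl]; exact hi
    · obtain ⟨l, rfl⟩ := Fin.exists_succAbove_eq hl
      exact Submodule.subset_span ⟨l, rfl⟩
  have htop : T = ⊤ := by
    rw [eq_top_iff]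
    intro x _
    obtain ⟨d, rfl⟩ := (Submodule.mem_span_range_iff_exists_fun _).1
      (hs ▸ Submodule.mem_top (x := x))
    exact sum_mem fun l _ => smul_mem_of_nodeRing T _ (hall l)
  have h1 := Submodule.spanRank_span_le_card (R := NodeRing k)
    (Set.range fun l => m (i.succAbove l))
  rw [← hT, htop, hmin] at h1
  have h2 := Cardinal.mk_range_le_lift (f := fun l => m (i.succAbove l))
  rw [Cardinal.lift_id', Cardinal.mk_fin] at h2
  have h3 := h1.trans h2
  rw [Cardinal.lift_natCast] at h3
  have : 3 ≤ 2 := by exact_mod_cast h3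
  omega

theorem linearIndependent_pow_smul {x : M} (hx : ∀ r : NodeRing k, r • x = 0 → r = 0) :
    LinearIndependent (MvPolynomial (Fin 2) k) fun i : Fin 3 => quot k (X 0) ^ (i : ℕ) • x := by
  rw [Fintype.linearIndependent_iff]
  intro a ha
  refine Fintype.linearIndependent_iff.1 (linearIndependent_pow k) a (hx _ ?_)
  rw [Finset.sum_smul, ← ha]
  exact Finset.sum_congr rfl fun i _ => smul_assoc _ _ _

/-- The homogeneous basis of a three-generated module of rank one lies in a single degree. -/
theorem degree_eq_degree (h : IsGraded (k := k) 𝓜) {m : Fin 3 → M} {e : Fin 3 → ℤ}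
    (hm : ∀ i, m i ∈ 𝓜 (e i))
    (hs : Submodule.span (MvPolynomial (Fin 2) k) (Set.range m) = ⊤)
    (hi : LinearIndependent (MvPolynomial (Fin 2) k) m) (hmin : IsMinimallyGenerated k M 3)
    (i j : Fin 3) : e i ≤ e j := by
  classical
  have hy : ∀ j, ∃ a : Fin 3 → MvPolynomial (Fin 2) k, quot k (X 0) • m j =
      ∑ i, intComponent (1 + e j - e i) (a i) • m i := by
    intro j
    exact exists_sum_of_mem h hm hs (by
      have := quot_smul_mem h (isHomogeneous_X k 0) (hm j)
      exact_mod_cast this)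
  choose a ha using hy
  -- A coefficient of y₁ m_j at a basis element of larger degree has degree at most zero. Were it a
  -- nonzero constant, m_i would be an R-combination of the other basis elements, against
  -- minimality.
  have hzero : ∀ i j, e j < e i → intComponent (1 + e j - e i) (a j i) = 0 := by
    intro i j hij
    rcases lt_or_eq_of_le (show 1 + e j - e i ≤ 0 by omega) with h0 | h0
    · exact intComponent_of_neg h0 _
    have ha' := ha j
    rw [Fin.sum_univ_succAbove _ i] at ha'
    rw [h0, intComponent_zero] at ha' ⊢
    set c := coeff 0 (a j i)
    by_contra hc
    have hc0 : c ≠ 0 := fun h => hc (by rw [h, C_0])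
    refine not_isMinimallyGenerated hs (i := i) ?_ hmin
    set T := Submodule.span (NodeRing k) (Set.range fun l => m (i.succAbove l))
    have hl : ∀ l, m (i.succAbove l) ∈ T := fun l => Submodule.subset_span ⟨l, rfl⟩
    have hj : m j ∈ T := by
      obtain ⟨l, rfl⟩ := Fin.exists_succAbove_eq (show j ≠ i by rintro rfl; omega)
      exact hl l
    have h1 : (C c : MvPolynomial (Fin 2) k) • m i ∈ T := by
      rw [← sub_eq_iff_eq_add] at ha'
      rw [← ha']
      exact sub_mem (T.smul_mem _ hj) (sum_mem fun l _ => smul_mem_of_nodeRing T _ (hl l))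
    have h2 := smul_mem_of_nodeRing T (C c⁻¹) h1
    rwa [smul_smul, ← C_mul, inv_mul_cancel₀ hc0, C_1, one_smul] at h2
  -- The basis elements of degree at most e j span a submodule N stable under y₁. It contains the
  -- independent elements m_j, y₁ m_j, y₁² m_j, so all three basis elements are among its
  -- generators.
  let s : Finset (Fin 3) := Finset.univ.filter fun i => e i ≤ e j
  let N := Submodule.span (MvPolynomial (Fin 2) k) (s.image m : Set M)
  have hms : ∀ i, e i ≤ e j → m i ∈ N := fun i hi => Submodule.subset_span (by
    simp only [Finset.coe_image, Set.mem_image, Finset.mem_coe]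
    exact ⟨i, by simp [s, hi], rfl⟩)
  have hstable : ∀ x ∈ N, quot k (X 0) • x ∈ N := by
    intro x hx
    induction hx using Submodule.span_induction with
    | mem x hx =>
      simp only [Finset.coe_image, Set.mem_image, Finset.mem_coe, s, Finset.mem_filter,
        Finset.mem_univ, true_and] at hx
      obtain ⟨l, hl, rfl⟩ := hx
      rw [ha l]
      refine sum_mem fun i _ => ?_
      rcases le_or_gt (e i) (e l) with h1 | h1
      · exact N.smul_mem _ (hms i (h1.trans hl))
      · rw [hzero i l h1, zero_smul]
        exact zero_mem _
    | zero => rw [smul_zero]; exact zero_mem _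
    | add x y _ _ hx hy => rw [smul_add]; exact add_mem hx hy
    | smul a x _ hx =>
      rw [smul_eq_quot_smul, smul_comm, ← smul_eq_quot_smul]
      exact N.smul_mem _ hx
  have hpow : ∀ n : ℕ, quot k (X 0) ^ n • m j ∈ N := by
    intro n
    induction n with
    | zero => rw [pow_zero, one_smul]; exact hms j le_rfl
    | succ n ih => rw [pow_succ', mul_smul]; exact hstable _ ih
  have hj0 : m j ≠ 0 := hi.ne_zero j
  have hindep : LinearIndependent (MvPolynomial (Fin 2) k)
      fun i : Fin 3 => quot k (X 0) ^ (i : ℕ) • m j := by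
    refine linearIndependent_pow_smul fun r hr => ?_
    by_contra hr0
    exact hj0 (smul_eq_zero_of_linearIndependent hs hi hr0 hr)
  have hcard := linearIndependent_le_span_aux' _ hindep (s.image m : Set M) (by
    rintro _ ⟨i, rfl⟩
    exact hpow i)
  have h3 : 3 ≤ s.card := by
    refine le_trans ?_ (Finset.card_image_le (s := s) (f := m))
    simpa using hcard
  have hs' : s = Finset.univ := Finset.eq_univ_of_card _ (le_antisymm (Finset.card_le_univ s)
    (by simpa using h3))
  have : i ∈ s := by rw [hs']; exact Finset.mem_univ i
  simpa [s] using this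

theorem exists_intComponent_one (a : MvPolynomial (Fin 2) k) :
    ∃ p q : k, intComponent 1 a = C p * X 0 + C q * X 1 := by
  have h : intComponent 1 a ∈ homogeneousSubmodule (Fin 2) k 1 := by
    have := intComponent_natCast 1 a
    rw [Nat.cast_one] at this
    rw [this]
    exact homogeneousComponent_isHomogeneous 1 a
  rw [homogeneousSubmodule_one_eq_span_X, Submodule.mem_span_range_iff_exists_fun] at h
  obtain ⟨c, hc⟩ := h
  refine ⟨c 0, c 1, ?_⟩
  rw [← hc, Fin.sum_univ_two, smul_eq_C_mul, smul_eq_C_mul]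

end Degrees

/-! ### From the matrix identity for Φ to identities for P and Q. -/

section Pair

variable {k : Type u} [Field k]

/-- The matrix `y₂ P + y₃ Q` of linear forms. -/
def pencil (P Q : Matrix (Fin 3) (Fin 3) k) : Matrix (Fin 3) (Fin 3) (MvPolynomial (Fin 2) k) :=
  (X 0 : MvPolynomial (Fin 2) k) • P.map C + (X 1 : MvPolynomial (Fin 2) k) • Q.map C

theorem pencil_mul_map {P Q P' Q' B : Matrix (Fin 3) (Fin 3) k} (hP : P * B = B * P')
    (hQ : Q * B = B * Q') : pencil P Q * B.map C = B.map C * pencil P' Q' := by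
  simp only [pencil, add_mul, mul_add, smul_mul_assoc, mul_smul_comm, ← Matrix.map_mul, hP, hQ]

/-- The identity is homogeneous of degree three, so nothing is lost by setting y₂ = 1, y₃ = T; the
four conditions are the coefficients of 1, T, T² and T³. -/
theorem isCubicPair_of_pencil {P Q : Matrix (Fin 3) (Fin 3) k}
    (h : pencil P Q * pencil P Q * pencil P Q +
      (X 1 : MvPolynomial (Fin 2) k) • (pencil P Q * pencil P Q) =
      (X 0 ^ 2 * X 1 : MvPolynomial (Fin 2) k) • 1) : IsCubicPair P Q := by
  generalize hΦ : pencil P Q = Φ at h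
  rw [pencil] at hΦ
  let ψ : MvPolynomial (Fin 2) k →+* Polynomial k := eval₂Hom Polynomial.C ![1, Polynomial.X]
  let P' := P.map (Polynomial.C : k →+* Polynomial k)
  let Q' := Q.map (Polynomial.C : k →+* Polynomial k)
  have hψ : Φ.map ψ = P' + (Polynomial.X : Polynomial k) • Q' := by
    rw [← hΦ]
    ext1 i j
    simp [ψ, P', Q']
  have h1 : (P' * P' * P') + (Polynomial.X : Polynomial k) •
        (P' * P' * Q' + P' * Q' * P' + Q' * P' * P' + P' * P') +
      (Polynomial.X ^ 2 : Polynomial k) •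
        (P' * Q' * Q' + Q' * P' * Q' + Q' * Q' * P' + P' * Q' + Q' * P') +
      (Polynomial.X ^ 3 : Polynomial k) • (Q' * Q' * Q' + Q' * Q') =
      (Polynomial.X : Polynomial k) • 1 := by
    have h2 := congrArg (fun A => A.map ψ) h
    have h3 : (Φ * Φ * Φ + (X 1 : MvPolynomial (Fin 2) k) • (Φ * Φ)).map ψ =
        Φ.map ψ * Φ.map ψ * Φ.map ψ + (Polynomial.X : Polynomial k) • (Φ.map ψ * Φ.map ψ) := by
      rw [← Matrix.map_mul, ← Matrix.map_mul]
      ext1 i j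
      simp [ψ]
    have h4 : ((X 0 ^ 2 * X 1 : MvPolynomial (Fin 2) k) •
        (1 : Matrix (Fin 3) (Fin 3) (MvPolynomial (Fin 2) k))).map ψ =
        (Polynomial.X : Polynomial k) • 1 := by
      ext1 i j
      by_cases hij : i = j
      · subst hij; simp [ψ]
      · simp [ψ, Matrix.one_apply_ne hij]
    simp only [h3, h4, hψ] at h2
    rw [← h2]
    simp only [add_mul, mul_add, smul_mul_assoc, mul_smul_comm, smul_add, smul_smul]
    module
  have hmap : ∀ i j, Polynomial.C ((P * P * P) i j) + Polynomial.X ^ 1 *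
        Polynomial.C ((P * P * Q + P * Q * P + Q * P * P + P * P) i j) +
      Polynomial.X ^ 2 * Polynomial.C ((P * Q * Q + Q * P * Q + Q * Q * P + P * Q + Q * P) i j) +
      Polynomial.X ^ 3 * Polynomial.C ((Q * Q * Q + Q * Q) i j) =
      Polynomial.X ^ 1 * Polynomial.C ((1 : Matrix (Fin 3) (Fin 3) k) i j) := by
    intro i j
    have h2 := congrFun (congrFun h1 i) j
    simp only [P', Q', ← Matrix.map_mul, Matrix.add_apply, Matrix.smul_apply, Matrix.map_apply,
      smul_eq_mul] at h2
    have h3 : (1 : Matrix (Fin 3) (Fin 3) (Polynomial k)) i j =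
        Polynomial.C ((1 : Matrix (Fin 3) (Fin 3) k) i j) := by
      by_cases hij : i = j
      · subst hij; simp
      · simp [Matrix.one_apply_ne hij]
    rw [h3] at h2
    simp only [Matrix.add_apply, Polynomial.C_add, pow_one]
    exact h2
  have hcoeff : ∀ (n : ℕ) (i j), _ := fun n i j =>
    congrArg (fun p => Polynomial.coeff p n) (hmap i j)
  simp only [Polynomial.coeff_add, Polynomial.coeff_X_pow_mul', Polynomial.coeff_C] at hcoeff
  refine ⟨?_, ?_, ?_, ?_⟩ <;> ext i j
  · simpa using hcoeff 0 i j
  · simpa using hcoeff 1 i j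
  · simpa using hcoeff 2 i j
  · simpa using hcoeff 3 i j

end Pair

section ChangeBasis

variable {k : Type u} [Field k] {M : Type v} [AddCommGroup M] [Module (MvPolynomial (Fin 2) k) M]
  {m : Fin 3 → M}

/-- The basis obtained by a matrix with constant entries. -/
def changeBasis (B : Matrix (Fin 3) (Fin 3) k) (m : Fin 3 → M) (j : Fin 3) : M :=
  ∑ i, (C (B i j) : MvPolynomial (Fin 2) k) • m i

theorem sum_changeBasis (B : Matrix (Fin 3) (Fin 3) k) (w : Fin 3 → MvPolynomial (Fin 2) k) :
    ∑ j, w j • changeBasis B m j = ∑ i, (B.map C).mulVec w i • m i := by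
  simp only [changeBasis, Finset.smul_sum, Matrix.mulVec, dotProduct, Finset.sum_smul]
  rw [Finset.sum_comm]
  refine Finset.sum_congr rfl fun i _ => Finset.sum_congr rfl fun j _ => ?_
  rw [smul_smul, Matrix.map_apply, mul_comm]

end ChangeBasis

/-! ### The action of y₁ in a basis. -/

section Action

variable {k : Type u} [Field k] {M : Type v} [AddCommGroup M] [Module (NodeRing k) M]
  [Module (MvPolynomial (Fin 2) k) M] [IsScalarTower (MvPolynomial (Fin 2) k) (NodeRing k) M]
  {P Q : Matrix (Fin 3) (Fin 3) k} {m : Fin 3 → M}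

theorem X_zero_smul_sum (hPQ : ∀ j, quot k (X 0) • m j = ∑ i, pencil P Q i j • m i)
    (v : Fin 3 → MvPolynomial (Fin 2) k) :
    quot k (X 0) • ∑ i, v i • m i = ∑ i, (pencil P Q).mulVec v i • m i := by
  rw [Finset.smul_sum]
  have h1 : ∀ j, quot k (X 0) • v j • m j = ∑ i, (pencil P Q i j * v j) • m i := by
    intro j
    rw [smul_eq_quot_smul, smul_comm, ← smul_eq_quot_smul, hPQ j, Finset.smul_sum]
    refine Finset.sum_congr rfl fun i _ => ?_
    rw [smul_smul, mul_comm]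
  simp_rw [h1]
  rw [Finset.sum_comm]
  refine Finset.sum_congr rfl fun i _ => ?_
  rw [← Finset.sum_smul]
  rfl

theorem exists_pencil {𝓜 : ℤ → AddSubgroup M} (h : IsGraded (k := k) 𝓜) {e : ℤ}
    (hm : ∀ i, m i ∈ 𝓜 e)
    (hs : Submodule.span (MvPolynomial (Fin 2) k) (Set.range m) = ⊤) :
    ∃ P Q : Matrix (Fin 3) (Fin 3) k, ∀ j, quot k (X 0) • m j = ∑ i, pencil P Q i j • m i := by
  have hlin : ∀ j, ∃ p q : Fin 3 → k, quot k (X 0) • m j =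
      ∑ i, (C (p i) * X 0 + C (q i) * X 1 : MvPolynomial (Fin 2) k) • m i := by
    intro j
    have h1 : quot k (X 0) • m j ∈ 𝓜 (1 + e) := by
      have := quot_smul_mem h (isHomogeneous_X k 0) (hm j)
      exact_mod_cast this
    obtain ⟨c, hc⟩ := exists_sum_of_mem (e := fun _ => e) h hm hs h1
    choose p q hpq using fun i => exists_intComponent_one (c i)
    refine ⟨p, q, ?_⟩
    rw [hc]
    refine Finset.sum_congr rfl fun i _ => ?_
    rw [add_sub_cancel_right, hpq i]
  choose p q hpq using hlin
  refine ⟨Matrix.of fun i j => p j i, Matrix.of fun i j => q j i, fun j => ?_⟩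
  rw [hpq j]
  refine Finset.sum_congr rfl fun i _ => ?_
  simp only [pencil, Matrix.add_apply, Matrix.smul_apply, Matrix.map_apply, Matrix.of_apply,
    smul_eq_mul, mul_comm]

/-- The matrices that describe the multiplication by `y₁` form a cubic pair. -/
theorem isCubicPair_of_linearIndependent
    (hPQ : ∀ j, quot k (X 0) • m j = ∑ i, pencil P Q i j • m i)
    (hi : LinearIndependent (MvPolynomial (Fin 2) k) m) : IsCubicPair P Q := by
  refine isCubicPair_of_pencil (Matrix.ext_of_mulVec_single fun i => ?_)
  -- Independence makes L injective, so y₁³ = y₃ (y₂² - y₁²) on M can be pulled back to an identity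
  -- for Φ.
  let L : (Fin 3 → MvPolynomial (Fin 2) k) →ₗ[MvPolynomial (Fin 2) k] M :=
    Fintype.linearCombination (MvPolynomial (Fin 2) k) m
  have hL : ∀ v, quot k (X 0) • L v = L ((pencil P Q).mulVec v) := X_zero_smul_sum hPQ
  have hLinj : Function.Injective L := by
    rw [injective_iff_map_eq_zero]
    exact fun v hv => funext (Fintype.linearIndependent_iff.1 hi v hv)
  generalize (Pi.single i 1 : Fin 3 → MvPolynomial (Fin 2) k) = v
  generalize pencil P Q = Φ at hL
  have h1 := cubic_relation (k := k) (L v)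
  have h2 : quot k (X 1 ^ 2 - X 0 ^ 2) • L v =
      L ((X 0 ^ 2 : MvPolynomial (Fin 2) k) • v - Φ.mulVec (Φ.mulVec v)) := by
    rw [map_sub (quot k), sub_smul, map_sub L, ← hL, ← hL, map_smul L, map_pow, map_pow, pow_two,
      pow_two, pow_two, mul_smul, mul_smul, mul_smul, X_zero_smul, X_zero_smul]
  rw [h2, hL, hL, hL, ← X_one_smul, ← map_smul L] at h1
  have h3 := hLinj h1
  rw [Matrix.add_mulVec, Matrix.smul_mulVec, Matrix.smul_mulVec, Matrix.one_mulVec,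
    ← Matrix.mulVec_mulVec, ← Matrix.mulVec_mulVec, ← Matrix.mulVec_mulVec, h3, smul_sub,
    smul_smul, mul_comm, sub_add_cancel]

theorem X_zero_smul_changeBasis
    (hPQ : ∀ j, quot k (X 0) • m j = ∑ i, pencil P Q i j • m i)
    {B P' Q' : Matrix (Fin 3) (Fin 3) k} (hP : P * B = B * P') (hQ : Q * B = B * Q') (j : Fin 3) :
    quot k (X 0) • changeBasis B m j = ∑ l, pencil P' Q' l j • changeBasis B m l := by
  rw [sum_changeBasis, changeBasis, X_zero_smul_sum hPQ]
  refine Finset.sum_congr rfl fun i _ => ?_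
  exact congrArg (· • m i) (congrFun (congrFun (pencil_mul_map hP hQ) i) j)

theorem span_changeBasis {B : Matrix (Fin 3) (Fin 3) k} (hB : IsUnit B)
    (hs : Submodule.span (MvPolynomial (Fin 2) k) (Set.range m) = ⊤) :
    Submodule.span (NodeRing k) (Set.range (changeBasis B m)) = ⊤ := by
  rw [eq_top_iff]
  intro x _
  obtain ⟨v, rfl⟩ := (Submodule.mem_span_range_iff_exists_fun _).1
    (hs ▸ Submodule.mem_top (x := x))
  have h1 : v = (B.map C).mulVec ((B⁻¹.map C).mulVec v) := by
    rw [Matrix.mulVec_mulVec, ← Matrix.map_mul,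
      Matrix.mul_nonsing_inv _ ((Matrix.isUnit_iff_isUnit_det B).1 hB),
      Matrix.map_one _ C_0 C_1, Matrix.one_mulVec]
  rw [h1, ← sum_changeBasis]
  exact sum_mem fun j _ => smul_mem_of_nodeRing _ _ (Submodule.subset_span ⟨j, rfl⟩)

theorem changeBasis_mem {𝓜 : ℤ → AddSubgroup M} (h : IsGraded (k := k) 𝓜) {e : ℤ}
    (hm : ∀ i, m i ∈ 𝓜 e) (B : Matrix (Fin 3) (Fin 3) k) (j : Fin 3) :
    changeBasis B m j ∈ 𝓜 e := by
  refine sum_mem fun i _ => ?_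
  have := quot_smul_mem h (isHomogeneous_C (Fin 3) (B i j)) (hm i)
  rw [Nat.cast_zero, zero_add] at this
  rwa [smul_eq_quot_smul, rename_C]

/-- The relations between generators in normal form are the columns of `α`. -/
theorem alpha_relations {a b : k}
    (hPQ : ∀ j, quot k (X 0) • m j = ∑ i, pencil (jordan k) (normalForm a b) i j • m i)
    (j : Fin 3) : ∑ i, quot k (alpha a b i j) • (![-m 1, m 0, -m 2] : Fin 3 → M) i = 0 := by
  -- Column j of α is, up to sign, the formula for y₁ m_j; the order and signs of the generators
  -- -m₁, m₀, -m₂ account for the difference in shape.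
  have e0 := hPQ 0
  have e1 := hPQ 1
  have e2 := hPQ 2
  simp only [Fin.sum_univ_three, pencil, jordan, normalForm, Matrix.of_apply, Matrix.cons_val',
    Matrix.cons_val_zero, Matrix.cons_val_one, Matrix.cons_val,
    smul_eq_quot_smul (k := k) (M := M), Matrix.add_apply, Matrix.smul_apply, Matrix.map_apply,
    smul_eq_mul, map_add, map_sub, map_mul, map_neg, map_pow, map_zero, map_one, rename_X,
    rename_C, Fin.succ_zero_eq_one, Fin.succ_one_eq_two] at e0 e1 e2
  fin_cases j <;>
    simp only [Fin.sum_univ_three, alpha, Matrix.of_apply, Matrix.cons_val', Matrix.cons_val_zero,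
      Matrix.cons_val_one, Matrix.cons_val, map_add, map_sub, map_mul, map_neg, map_pow, map_zero,
      map_one, Fin.zero_eta, Fin.mk_one, Fin.reduceFinMk]
  · linear_combination (norm := module) e0
  · linear_combination (norm := module) -e1
  · linear_combination (norm := module) e2

end Action

/-! ### The classification of three-generated modules of rank one. -/

section Classification

variable {k : Type u} [Field k] {M : Type v} [AddCommGroup M] [Module (NodeRing k) M]
  {𝓜 : ℤ → AddSubgroup M}

/-- A graded module of rank one whose generators satisfy the relations `α` is a shift of the
cokernel of `α`. -/
theorem isoUpToShift_of_relations (h : IsGraded (k := k) 𝓜)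
    (hrank : Module.rank (NodeRing k) M = 1) {a b : k} (hab : b ^ 2 = a ^ 3 + a ^ 2)
    {g : Fin 3 → M} {e : ℤ} (hg : ∀ i, g i ∈ 𝓜 e)
    (hs : Submodule.span (NodeRing k) (Set.range g) = ⊤)
    (hrel : ∀ j, ∑ i, quot k (alpha a b i j) • g i = 0) :
    IsoUpToShift (k := k) 𝓜 (cokerDeg (alpha a b)) := by
  let φ : Coker (alpha a b) →ₗ[NodeRing k] M :=
    Submodule.liftQ _ (Fintype.linearCombination (NodeRing k) g) (range_le_ker _ hrel)
  have hφ : ∀ x, φ (Submodule.Quotient.mk x) = ∑ i, x i • g i := fun x => rfl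
  have hsurj : Function.Surjective φ := by
    intro x
    obtain ⟨c, hc⟩ := (Submodule.mem_span_range_iff_exists_fun _).1
      (hs ▸ Submodule.mem_top (x := x))
    exact ⟨Submodule.Quotient.mk c, hc⟩
  have hinj : Function.Injective φ := by
    have h1 := LinearMap.lift_rank_range_add_rank_ker φ
    -- Equal ranks leave a kernel of rank zero, that is a torsion submodule of a torsion-free
    -- module.
    rw [rank_coker_alpha hab, LinearMap.range_eq_top.2 hsurj, rank_top, hrank,
      Cardinal.lift_one, Cardinal.lift_one] at h1
    have h2 := Cardinal.eq_of_add_eq_add_left (h1.trans (add_zero 1).symm) Cardinal.one_lt_aleph0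
    rw [Cardinal.lift_eq_zero, rank_eq_zero_iff] at h2
    rw [injective_iff_map_eq_zero]
    intro x hx
    obtain ⟨r, hr, hrx⟩ := h2 ⟨x, hx⟩
    exact coker_alpha_smul_eq_zero hab hr (congrArg Subtype.val hrx)
  -- The generators of the cokernel have degree 1 and are sent to degree e, hence the shift e - 1.
  have hdeg : ∀ j, ∀ x ∈ cokerDeg (alpha a b) j, φ x ∈ 𝓜 (j + (e - 1)) := by
    rintro j _ ⟨z, hz, rfl⟩
    change ∑ i, z i • g i ∈ _
    refine sum_mem fun i _ => ?_
    have := h.2 _ _ _ _ (hz i trivial) (hg i)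
    rwa [show j - 1 + e = j + (e - 1) by ring] at this
  let E := LinearEquiv.ofBijective φ ⟨hinj, hsurj⟩
  refine ⟨1 - e, E.symm, fun j x => ?_⟩
  have h1 := mem_iff_of_homogeneous h.1 (isGraded_cokerDeg_alpha hab).1 φ.toAddMonoidHom hinj
    (e - 1) hdeg (j + (1 - e)) (E.symm x)
  have h2 : φ.toAddMonoidHom (E.symm x) = x := E.apply_symm_apply x
  rw [h2, show j + (1 - e) + (e - 1) = j by ring] at h1
  exact h1.symm

theorem exists_isoUpToShift (hM : IsGradedMCM (k := k) 𝓜) (hmin : IsMinimallyGenerated k M 3)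
    (hrank : Module.rank (NodeRing k) M = 1) :
    ∃ a b : k, b ^ 2 = a ^ 3 + a ^ 2 ∧ IsoUpToShift (k := k) 𝓜 (cokerDeg (alpha a b)) := by
  obtain ⟨hfin, h, rs, hrs, hlen, hreg⟩ := hM
  rw [ringKrullDim_nodeRing] at hlen
  have hlen' : rs.length = 2 := by exact_mod_cast hlen
  obtain ⟨r, s, rfl⟩ := List.length_eq_two.1 hlen'
  have hr := hrs r (by simp)
  have hs := hrs s (by simp)
  have hw := hreg.toIsWeaklyRegular
  let _ : Module (MvPolynomial (Fin 2) k) M := Module.compHom M (algebraMap _ (NodeRing k))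
  have : IsScalarTower (MvPolynomial (Fin 2) k) (NodeRing k) M :=
    IsScalarTower.of_algebraMap_smul fun _ _ => rfl
  obtain ⟨n, m, e, hme, hspan, hind⟩ := exists_homogeneous_basis (k := k) h
    (fun x hx => X_two_smul_injective h hr hs hw x (by rwa [← X_one_smul]))
    (fun x x' hx => by
      rw [X_zero_smul, X_one_smul] at hx
      obtain ⟨w, hw⟩ := exists_eq_X_two_smul h hr hs hw x x' hx
      exact ⟨w, by rwa [X_one_smul]⟩)
  obtain rfl := card_eq_three_of_rank hspan hind hrank
  have hdeg : ∀ i, m i ∈ 𝓜 (e 0) := fun i => by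
    have := le_antisymm (degree_eq_degree h hme hspan hind hmin i 0)
      (degree_eq_degree h hme hspan hind hmin 0 i)
    rw [← this]
    exact hme i
  obtain ⟨P, Q, hPQ⟩ := exists_pencil h hdeg hspan
  obtain ⟨B, a, b, hB, hPB, hQB, hab⟩ :=
    (isCubicPair_of_linearIndependent hPQ hind).exists_normalForm
  refine ⟨a, b, hab, isoUpToShift_of_relations h hrank hab (e := e 0)
    (g := ![-changeBasis B m 1, changeBasis B m 0, -changeBasis B m 2]) ?_ ?_
    (alpha_relations (X_zero_smul_changeBasis hPQ hPB hQB))⟩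
  · rw [Fin.forall_fin_succ, Fin.forall_fin_two]
    exact ⟨neg_mem (changeBasis_mem h hdeg B 1), changeBasis_mem h hdeg B 0,
      neg_mem (changeBasis_mem h hdeg B 2)⟩
  · rw [eq_top_iff, ← span_changeBasis hB hspan, Submodule.span_le]
    have h1 := fun i => Submodule.subset_span (R := NodeRing k)
      (Set.mem_range_self (f := ![-changeBasis B m 1, changeBasis B m 0, -changeBasis B m 2]) i)
    rintro _ ⟨j, rfl⟩
    fin_cases j
    · exact h1 1
    · exact (Submodule.neg_mem_iff _).1 (h1 0)
    · exact (Submodule.neg_mem_iff _).1 (h1 2)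

end Classification

end NodalCone

end

open NodalCone
theorem mainTheorem6 (k : Type*) [Field k] :
    (∀ a b : k, pt a b ∈ curve k →
      IsMatrixFactorization (cubic k) (alpha a b) (beta a b)) ∧
    (∀ a b : k, pt a b ∈ regularLocus k \ {pt₀ k} →
      IsGradedMCM (k := k) (cokerDeg (alpha a b)) ∧
      IsMinimallyGenerated k (Coker (alpha a b)) 3 ∧
      Module.rank (NodeRing k) (Coker (alpha a b)) = 1) ∧
    (∀ a b c d : k, pt a b ∈ regularLocus k \ {pt₀ k} → pt c d ∈ regularLocus k \ {pt₀ k} →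
      pt a b ≠ pt c d →
      IsEmpty (Coker (alpha a b) ≃ₗ[NodeRing k] Coker (alpha c d))) ∧
    (∀ (M : Type*) [AddCommGroup M] [Module (NodeRing k) M] (𝓜 : ℤ → AddSubgroup M),
      IsGradedMCM (k := k) 𝓜 → IsMinimallyGenerated k M 3 →
      Module.rank (NodeRing k) M = 1 →
      (∃ a b : k, pt a b ∈ regularLocus k \ {pt₀ k} ∧
        IsoUpToShift (k := k) 𝓜 (cokerDeg (alpha a b))) ∨
      IsoUpToShift (k := k) 𝓜 (cokerDeg (alpha (0 : k) 0))) := by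
  refine ⟨fun a b h => isMatrixFactorization_alpha (pt_mem_curve_iff.1 h), fun a b h => ?_,
    fun a b c d _ _ hne => ⟨fun e => hne ?_⟩, fun M _ _ 𝓜 hM hmin hrank => ?_⟩
  · have hab := pt_mem_curve_iff.1 h.1.1
    exact ⟨isGradedMCM_coker_alpha hab, isMinimallyGenerated_coker (isHomogeneous_alpha a b),
      rank_coker_alpha hab⟩
  · obtain ⟨rfl, rfl⟩ := alpha_parameters_eq_of_equiv e
    rfl
  · obtain ⟨a, b, hab, hiso⟩ := exists_isoUpToShift hM hmin hrank
    -- The parameters (0, 0) give the singular point s; any other point of the chart on the curve is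
    -- regular and different from λ₀.
    by_cases h0 : a = 0 ∧ b = 0
    · obtain ⟨rfl, rfl⟩ := h0
      exact Or.inr hiso
    · exact Or.inl ⟨a, b, pt_mem_regularLocus hab h0, hiso⟩
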